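/- Let $A$ be an artin algebra, i.e. an algebra over a commutative artinian ring $R$ which is finitely generated as an $R$-module. "Module" means left $A$-module of finite length, unless right modules are mentioned. For a left or right module $M$ let $M^*=\operatorname{Hom}(M,A)$ be its $A$-dual (a right, respectively left, module), and let $\phi_M\colon M\to M^{**}$, $\phi_M(m)(f)=f(m)$, be the canonical map. A module $M$ is *semi-Gorenstein-projective* if $\operatorname{Ext}^i(M,A)=0$ for all $i\ge 1$ (similarly for right modules), and *reduced* if it has no non-zero projective direct summand. A complex $P_\bullet=(P_i,f_i\colon P_i\to P_{i-1})_{i\in\mathbb Z}$ of projective modules is *minimal* if the image of $f_i$ is contained in the radical of $P_{i-1}$ for all $i\in\mathbb Z$; its $A$-dual $P_\bullet^*$ consists of the modules $P_i^*$ and the maps $f_i^*\colon P_{i-1}^*\to P_i^*$. **Theorem.** There is a bijection $\Phi$ from the set of isomorphism classes of reduced modules $M$ such that both $M$ and $M^*$ are semi-Gorenstein-projective onto the set of isomorphism classes of minimal complexes $P_\bullet$ of projective modules such that $H_i(P_\bullet)=0$ for $i\ne 0,-1$ and such that $P_\bullet^*$ is acyclic. It is given as follows. (1) Let $M$ be a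 reduced module such that $M$ and $M^*$ are semi-Gorenstein-projective. Then $M$ and $M^*$ have minimal projective resolutions (by modules, respectively right modules, of finite length). Let $$\cdots\to P_2\xrightarrow{f_2}P_1\xrightarrow{f_1}P_0\xrightarrow{e}M\to 0\qquad\text{and}\qquad \cdots\to Q_2\xrightarrow{d_2}Q_1\xrightarrow{d_1}Q_0\xrightarrow{q}M^*\to 0$$ be any such minimal projective resolutions. Put $P_i=Q_{-i-1}^*$ and $f_i=d_{-i}^*$ for $i<0$, and $f_0=q^*\phi_M e\colon P_0\to P_{-1}$. Then $P_\bullet=(P_i,f_i)_{i\in\mathbb Z}$ is a minimal complex of projective modules with $H_i(P_\bullet)=0$ for $i\ne 0,-1$ and with $P_\bullet^*$ acyclic, and $\Phi$ sends the isomorphism class of $M$ to that of $P_\bullet$. Moreover, canonically, $M=\operatorname{Cok} f_1$ (via $e$), $M^*=\operatorname{Cok} d_1=\operatorname{Cok} f_{-1}^*$ (via $q$ and the canonical map $Q_0\to Q_0^{**}$), $H_0(P_\bullet)=\operatorname{Ker}\phi_M$ (via $e$) and $H_{-1}(P_\bullet)=\operatorname{Cok}\phi_M$ (via $q^*$). (2)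 Conversely, let $P_\bullet=(P_i,f_i)_{i\in\mathbb Z}$ be a minimal complex of projective modules with $H_i(P_\bullet)=0$ for $i\ne 0,-1$ and with $P_\bullet^*$ acyclic, and let $M=\operatorname{Cok} f_1$. Then $M$ is reduced, both $M$ and $M^*$ are semi-Gorenstein-projective, and $\Phi^{-1}$ sends the isomorphism class of $P_\bullet$ to that of $M$. Moreover, canonically, $M^*=\operatorname{Cok} f_{-1}^*$ and $M^{**}=\operatorname{Ker} f_{-1}$. -/

import Mathlib

universe u

open CategoryTheory CategoryTheory.Limits

noncomputable section

namespace SemiGorenstein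

variable {A : Type u} [Ring A]

/-! Left `A`-modules are objects of `ModuleCat.{u} A`, right `A`-modules are objects of
`ModuleCat.{u} Aᵐᵒᵖ`. The ring `A` is a left module over itself through `A` and a right module
over itself through `Aᵐᵒᵖ` (multiplication on the right). -/

/-- The `A`-dual `M* = Hom_A(M, A)` of a left module, a right module by `(f a)(m) = f(m) a`. -/
def dual (M : ModuleCat.{u} A) : ModuleCat.{u} Aᵐᵒᵖ := ModuleCat.of Aᵐᵒᵖ (M →ₗ[A] A)

/-- The `A`-dual `N* = Hom_A(N, A_A)` of a right module, a left module by `(a f)(n) = a f(n)`. -/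
def dualRight (N : ModuleCat.{u} Aᵐᵒᵖ) : ModuleCat.{u} A := ModuleCat.of A (N →ₗ[Aᵐᵒᵖ] A)

/-- `f* = (- ∘ f) : M'* ⟶ M*` for a map `f : M ⟶ M'` of left modules. -/
def dualMap {M M' : ModuleCat.{u} A} (f : M ⟶ M') : dual M' ⟶ dual M :=
  ModuleCat.ofHom
    { toFun := fun (g : M' →ₗ[A] A) => (g ∘ₗ f.hom : M →ₗ[A] A)
      map_add' := fun _ _ => rfl
      map_smul' := fun _ _ => rfl }

/-- `f* = (- ∘ f) : N'* ⟶ N*` for a map `f : N ⟶ N'` of right modules. -/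
def dualRightMap {N N' : ModuleCat.{u} Aᵐᵒᵖ} (f : N ⟶ N') : dualRight N' ⟶ dualRight N :=
  ModuleCat.ofHom
    { toFun := fun (g : N' →ₗ[Aᵐᵒᵖ] A) => (g ∘ₗ f.hom : N →ₗ[Aᵐᵒᵖ] A)
      map_add' := fun _ _ => rfl
      map_smul' := fun _ _ => rfl }

/-- The canonical map `φ_M : M ⟶ M**`, `φ_M(m)(f) = f(m)`, for a left module `M`. -/
def phi (M : ModuleCat.{u} A) : M ⟶ dualRight (dual M) :=
  ModuleCat.ofHom
    { toFun := fun m =>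
        ({ toFun := fun (f : M →ₗ[A] A) => f m
           map_add' := fun _ _ => rfl
           map_smul' := fun _ _ => rfl } : (M →ₗ[A] A) →ₗ[Aᵐᵒᵖ] A)
      map_add' := fun m m' => LinearMap.ext fun (f : M →ₗ[A] A) => f.map_add m m'
      map_smul' := fun a m => LinearMap.ext fun (f : M →ₗ[A] A) => f.map_smul a m }

/-- The canonical map `φ_N : N ⟶ N**`, `φ_N(n)(f) = f(n)`, for a right module `N`. -/
def phiRight (N : ModuleCat.{u} Aᵐᵒᵖ) : N ⟶ dual (dualRight N) :=
  ModuleCat.ofHom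
    { toFun := fun n =>
        ({ toFun := fun (f : N →ₗ[Aᵐᵒᵖ] A) => f n
           map_add' := fun _ _ => rfl
           map_smul' := fun _ _ => rfl } : (N →ₗ[Aᵐᵒᵖ] A) →ₗ[A] A)
      map_add' := fun n n' => LinearMap.ext fun (f : N →ₗ[Aᵐᵒᵖ] A) => f.map_add n n'
      map_smul' := fun a n => LinearMap.ext fun (f : N →ₗ[Aᵐᵒᵖ] A) => f.map_smul a n }

lemma dualMap_comp {M M' M'' : ModuleCat.{u} A} (f : M ⟶ M') (g : M' ⟶ M'') :
    dualMap (f ≫ g) = dualMap g ≫ dualMap f := rfl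

lemma dualMap_zero (M M' : ModuleCat.{u} A) : dualMap (0 : M ⟶ M') = 0 := by
  ext (g : M' →ₗ[A] A)
  exact LinearMap.ext fun _ => g.map_zero

lemma dualRightMap_comp {N N' N'' : ModuleCat.{u} Aᵐᵒᵖ} (f : N ⟶ N') (g : N' ⟶ N'') :
    dualRightMap (f ≫ g) = dualRightMap g ≫ dualRightMap f := rfl

lemma dualRightMap_zero (N N' : ModuleCat.{u} Aᵐᵒᵖ) : dualRightMap (0 : N ⟶ N') = 0 := by
  ext (g : N' →ₗ[Aᵐᵒᵖ] A)
  exact LinearMap.ext fun _ => g.map_zero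

/-- The `A`-dual `P_•*` of a complex `P_• = (P_i, f_i : P_i ⟶ P_{i-1})` of left modules:
it has `P_i*` in degree `i` and the differential `f_i* : P_{i-1}* ⟶ P_i*`. -/
def dualComplex (P : ChainComplex (ModuleCat.{u} A) ℤ) :
    CochainComplex (ModuleCat.{u} Aᵐᵒᵖ) ℤ where
  X i := dual (P.X i)
  d i j := dualMap (P.d j i)
  shape i j h := by
    rw [P.shape j i h, dualMap_zero]
  d_comp_d' i j k _ _ := by
    rw [← dualMap_comp, P.d_comp_d, dualMap_zero]

/-- A module is reduced if it has no non-zero projective direct summand. -/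
def IsReducedModule (M : ModuleCat.{u} A) : Prop :=
  ∀ U V : Submodule A M, IsCompl U V → Module.Projective A U → U = ⊥

/-- `Ext^i(M, A) = 0` for all `i ≥ 1`, for a left module `M`. -/
def IsSemiGorensteinProjective (M : ModuleCat.{u} A) : Prop :=
  ∀ i : ℕ, 1 ≤ i → Subsingleton (Abelian.Ext M (ModuleCat.of A A) i)

/-- `Ext^i(N, A_A) = 0` for all `i ≥ 1`, for a right module `N`. -/
def IsSemiGorensteinProjectiveRight (N : ModuleCat.{u} Aᵐᵒᵖ) : Prop :=
  ∀ i : ℕ, 1 ≤ i → Subsingleton (Abelian.Ext N (ModuleCat.of Aᵐᵒᵖ A) i)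

variable (A) in
/-- The reduced left modules `M` of finite length such that both `M` and `M*` are
semi-Gorenstein-projective. -/
def goodModule : ObjectProperty (ModuleCat.{u} A) := fun M =>
  IsFiniteLength A M ∧ IsReducedModule M ∧
    IsSemiGorensteinProjective M ∧ IsSemiGorensteinProjectiveRight (dual M)

/-- A complex `(P_i, f_i : P_i ⟶ P_{i-1})` is minimal if `Im f_i` is contained in the radical of
`P_{i-1}` for all `i`. -/
def IsMinimalComplex (P : ChainComplex (ModuleCat.{u} A) ℤ) : Prop :=
  ∀ i : ℤ, LinearMap.range (P.d i (i - 1)).hom ≤ Module.jacobson A (P.X (i - 1))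

variable (A) in
/-- The minimal complexes `P_•` of projective left modules (of finite length) with
`H_i(P_•) = 0` for `i ≠ 0, -1` whose `A`-dual `P_•*` is acyclic. -/
def goodComplex : ObjectProperty (ChainComplex (ModuleCat.{u} A) ℤ) := fun P =>
  (∀ i, IsFiniteLength A (P.X i) ∧ Module.Projective A (P.X i)) ∧
    IsMinimalComplex P ∧
    (∀ i, i ≠ 0 → i ≠ -1 → IsZero (P.homology i)) ∧
    (dualComplex P).Acyclic

/-- The isomorphism classes of the objects of `C` that have the property `p`. -/
abbrev IsoClasses {C : Type*} [Category C] (p : ObjectProperty C) :=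
  Quotient (isIsomorphicSetoid p.FullSubcategory)

/-- The isomorphism class of an object `X` that has the property `p`. -/
abbrev isoClass {C : Type*} [Category C] (p : ObjectProperty C) (X : C) (h : p X) :
    IsoClasses p :=
  Quotient.mk (isIsomorphicSetoid p.FullSubcategory) ⟨X, h⟩

/-- The augmentation `P_0 ⟶ M` of a projective resolution of a module `M`. -/
def augmentation {B : Type u} [Ring B] {M : ModuleCat.{u} B} (P : ProjectiveResolution M) :
    P.complex.X 0 ⟶ M :=
  P.π.f 0 ≫ (HomologicalComplex.singleObjXSelf (ComplexShape.down ℕ) 0 M).hom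

/-- The kernel of `f` is superfluous (small): a projective cover is an epimorphism with
this property from a projective module. -/
def HasSuperfluousKernel {B : Type u} [Ring B] {M N : ModuleCat.{u} B} (f : M ⟶ N) : Prop :=
  ∀ U : Submodule B M, U ⊔ LinearMap.ker f.hom = ⊤ → U = ⊤

/-- A projective resolution `⋯ ⟶ P_1 ⟶ P_0 ⟶ M` by modules of finite length is minimal if
`P_0 ⟶ M` is a projective cover of `M` and every `P_{n+1} ⟶ P_n` is a projective cover of
its image. -/
def IsMinimalResolution {B : Type u} [Ring B] {M : ModuleCat.{u} B}
    (P : ProjectiveResolution M) : Prop :=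
  (∀ n, IsFiniteLength B (P.complex.X n)) ∧
    HasSuperfluousKernel (augmentation P) ∧
    ∀ n, HasSuperfluousKernel (P.complex.d (n + 1) n)

section Splice

variable {M : ModuleCat.{u} A} (P : ProjectiveResolution M) (Q : ProjectiveResolution (dual M))

/-- The modules of the spliced complex: `P_i` for `i ≥ 0`, and `Q_{-i-1}*` for `i < 0`. -/
def spliceX : ℤ → ModuleCat.{u} A
  | Int.ofNat n => P.complex.X n
  | Int.negSucc n => dualRight (Q.complex.X n)

/-- The differential of the spliced complex from degree `i + 1` to degree `i`: it is `f_{i+1}`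
for `i ≥ 0`, the composition `P_0 ⟶ M ⟶ M** ⟶ Q_0*` of `e`, `φ_M` and `q*` for `i = -1`,
and `d_{-i-1}*` for `i < -1`. -/
def spliceD : ∀ i : ℤ, spliceX P Q (i + 1) ⟶ spliceX P Q i
  | Int.ofNat n => P.complex.d (n + 1) n
  | Int.negSucc 0 => augmentation P ≫ phi M ≫ dualRightMap (augmentation Q)
  | Int.negSucc (n + 1) => dualRightMap (Q.complex.d (n + 1) n)

lemma d_comp_augmentation {B : Type u} [Ring B] {M : ModuleCat.{u} B}
    (P : ProjectiveResolution M) : P.complex.d 1 0 ≫ augmentation P = 0 := by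
  rw [augmentation, ← Category.assoc, P.complex_d_comp_π_f_zero, zero_comp]

lemma spliceD_comp (i : ℤ) : spliceD P Q (i + 1) ≫ spliceD P Q i = 0 := by
  match i with
  | Int.ofNat n => exact P.complex.d_comp_d (n + 2) (n + 1) n
  | Int.negSucc 0 =>
    change P.complex.d 1 0 ≫ augmentation P ≫ phi M ≫ dualRightMap (augmentation Q) = 0
    rw [← Category.assoc, d_comp_augmentation, zero_comp]
  | Int.negSucc 1 =>
    change (augmentation P ≫ phi M ≫ dualRightMap (augmentation Q)) ≫
      dualRightMap (Q.complex.d 1 0) = 0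
    rw [Category.assoc, Category.assoc, ← dualRightMap_comp, d_comp_augmentation,
      dualRightMap_zero, comp_zero, comp_zero]
  | Int.negSucc (n + 2) =>
    change dualRightMap (Q.complex.d (n + 1) n) ≫ dualRightMap (Q.complex.d (n + 2) (n + 1)) = 0
    rw [← dualRightMap_comp, Q.complex.d_comp_d, dualRightMap_zero]

/-- The complex `⋯ ⟶ P_1 ⟶ P_0 ⟶ Q_0* ⟶ Q_1* ⟶ ⋯` with `P_0` in degree `0`. -/
def splice : ChainComplex (ModuleCat.{u} A) ℤ :=
  ChainComplex.of (spliceX P Q) (spliceD P Q) (spliceD_comp P Q)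

end Splice

end SemiGorenstein

end

/-!
Both directions of the bijection rest on two facts about finitely generated projective modules over
an artin algebra `A`. The duality `P ↦ P*` is an equivalence on them up to the canonical map `φ`
(`phi_bijective`, `phiRight_bijective`), and it preserves maps with image in the radical
(`range_dualMap_le_jacobson`, `range_dualRightMap_le_jacobson`); the latter uses that the left and
the right radical of `A` agree. Left and right modules are treated together by means of a symmetric
notion of regular bimodule.

For a module `M` with minimal resolutions `P_• ⟶ M` and `Q_• ⟶ M*`, the vanishing of `Ext^i(M, A)`
and `Ext^i(M*, A)` for `i ≥ 1` says that `P_•*` and `Q_•*` are exact in positive degrees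
(`isSemiGorensteinProjective_iff`). The map `P_0 ⟶ M ⟶ M** ⟶ Q_0*` at the splice has as its dual,
after identifying `Q_0**` with `Q_0`, the composition `Q_0 ⟶ M* ⟶ P_0*` of an epimorphism and a
monomorphism. Hence the dual of the spliced complex is acyclic (`acyclic_dualComplex_splice`),
whereas the spliced complex itself has the homology of `0 ⟶ M ⟶ M** ⟶ 0` at the splice
(`exists_homology_splice_zero_iso`, `exists_homology_splice_neg_one_iso`). It is minimal at the
splice because a map from a reduced module to a projective module has its image in the radical
(`range_le_jacobson_of_isReducedModule`).

Conversely, for a complex `P_•` as in the theorem, let `M = Cok f_1`, so that `f_0` is a composition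
`P_0 ⟶ M ⟶ P_{-1}`. The non-negative part of `P_•` is a minimal resolution of `M`. Since `P_•*` is
acyclic, the dual of the negative part, augmented by the dual of `M ⟶ P_{-1}`, is a minimal
resolution of `M*`. These resolutions compute the `Ext` groups in question
(`goodComplex.goodModule`), and `P_•` is isomorphic to the complex spliced from them
(`goodComplex.nonempty_iso_splice`). As minimal resolutions are unique (`isIso_lift`), the
isomorphism class of `P_•` is determined by that of `M`; so `P_• ↦ Cok f_1` is injective on
isomorphism classes (`cokernelClass_bijective`), and it is surjective since `Cok f_1 = M` for a
spliced complex. The map `Φ` is its inverse.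
-/

noncomputable section

namespace SemiGorenstein

/-! ### Radicals, superfluous submodules and projective covers -/

section Radical

variable {B : Type*} [Ring B] {M : Type*} [AddCommGroup M] [Module B M]

theorem eq_top_of_sup_eq_top_of_le_jacobson [Module.Finite B M] {U N : Submodule B M}
    (hN : N ≤ Module.jacobson B M) (h : U ⊔ N = ⊤) : U = ⊤ := by
  by_contra hU
  obtain ⟨m, hm, hUm⟩ := (eq_top_or_exists_le_coatom U).resolve_left hU
  exact hm.1 (top_le_iff.mp (h ▸ sup_le hUm (hN.trans (sInf_le hm))))

theorem le_jacobson_of_superfluous {N : Submodule B M}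
    (h : ∀ U : Submodule B M, U ⊔ N = ⊤ → U = ⊤) : N ≤ Module.jacobson B M := by
  refine le_sInf fun m hm => ?_
  by_contra hN
  exact hm.1 (h m (hm.2 _ (left_lt_sup.mpr hN)))

theorem surjective_of_comp_surjective_of_superfluous {N L : Type*} [AddCommGroup N] [Module B N]
    [AddCommGroup L] [Module B L] {p : M →ₗ[B] L} {g : N →ₗ[B] M}
    (hp : ∀ U : Submodule B M, U ⊔ LinearMap.ker p = ⊤ → U = ⊤)
    (h : Function.Surjective (p ∘ₗ g)) : Function.Surjective g := by
  refine LinearMap.range_eq_top.mp (hp _ ?_)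
  refine eq_top_iff.mpr fun x _ => ?_
  obtain ⟨y, hy⟩ := h (p x)
  refine Submodule.mem_sup.mpr ⟨g y, ⟨y, rfl⟩, x - g y, ?_, by abel⟩
  rw [LinearMap.mem_ker, map_sub, sub_eq_zero]
  exact hy.symm

end Radical

section Artinian

variable {B : Type u} [Ring B] [IsArtinianRing B]

theorem isFiniteLength_iff_finite {M : Type*} [AddCommGroup M] [Module B M] :
    IsFiniteLength B M ↔ Module.Finite B M := by
  rw [isFiniteLength_iff_isNoetherian_isArtinian]
  refine ⟨fun h => ?_, fun h => ⟨inferInstance, inferInstance⟩⟩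
  have := h.1
  infer_instance

/-- Over an artinian ring every finitely generated module has a projective cover. Among the
projective submodules of a free module `F` of finite rank that are mapped onto `M` by some
surjection `F → M`, choose a minimal one, `P`. If a submodule `V` of `P` is still mapped onto `M`,
then `P → M` factors through an endomorphism of `P` with image in `V`; by Fitting's lemma the image
of a power of this endomorphism is a direct summand of `P`, hence equal to `P` by minimality. -/
theorem exists_projectiveCover (M : Type u) [AddCommGroup M] [Module B M] [Module.Finite B M] :
    ∃ (P : ModuleCat.{u} B) (p : P →ₗ[B] M), Module.Finite B P ∧ Module.Projective B P ∧
      Function.Surjective p ∧ ∀ U : Submodule B P, U ⊔ LinearMap.ker p = ⊤ → U = ⊤ := by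
  obtain ⟨n, q, hq⟩ := Module.Finite.exists_fin' B M
  let S : Set (Submodule B (Fin n → B)) :=
    {U | Module.Projective B U ∧ Function.Surjective (q ∘ₗ U.subtype)}
  have hS : S.Nonempty := ⟨⊤, Module.Projective.of_equiv (Submodule.topEquiv).symm, fun x => by
    obtain ⟨y, hy⟩ := hq x
    exact ⟨⟨y, trivial⟩, hy⟩⟩
  obtain ⟨P, ⟨hP, hPq⟩, hmin⟩ := IsArtinian.set_has_minimal S hS
  refine ⟨ModuleCat.of B P, q ∘ₗ P.subtype, inferInstanceAs (Module.Finite B P), hP, hPq, ?_⟩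
  intro (V : Submodule B P) hV
  have hVs : Function.Surjective ((q ∘ₗ P.subtype) ∘ₗ V.subtype) := fun x => by
    obtain ⟨y, rfl⟩ := hPq x
    obtain ⟨v, hv, k, hk, rfl⟩ := Submodule.mem_sup.mp (hV ▸ Submodule.mem_top (x := y))
    refine ⟨⟨v, hv⟩, ?_⟩
    rw [map_add, LinearMap.mem_ker.mp hk, add_zero]
    rfl
  obtain ⟨g, hg⟩ := Module.projective_lifting_property _ (q ∘ₗ P.subtype) hVs
  let h : Module.End B P := V.subtype ∘ₗ g
  have hh : (q ∘ₗ P.subtype) ∘ₗ h = q ∘ₗ P.subtype := hg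
  have hpow : ∀ k : ℕ, (q ∘ₗ P.subtype) ∘ₗ (h ^ k) = q ∘ₗ P.subtype := by
    intro k
    induction k with
    | zero => rfl
    | succ k ih => rw [pow_succ', Module.End.mul_eq_comp, ← LinearMap.comp_assoc, hh, ih]
  obtain ⟨k, hk⟩ := (h.eventually_isCompl_ker_pow_range_pow.and
    (Filter.eventually_ge_atTop 1)).exists
  obtain ⟨hk, hk1⟩ := hk
  have hR : Module.Projective B (LinearMap.range (h ^ k)) :=
    Module.Projective.of_split (LinearMap.range (h ^ k)).subtype
      (Submodule.projectionOnto _ _ hk.symm) (by ext x; simp)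
  have hmem : (LinearMap.range (h ^ k)).map P.subtype ∈ S := by
    refine ⟨Module.Projective.of_equiv
      (Submodule.equivMapOfInjective P.subtype P.injective_subtype _), fun x => ?_⟩
    obtain ⟨y, rfl⟩ := hPq x
    exact ⟨⟨_, Submodule.mem_map_of_mem ⟨y, rfl⟩⟩, LinearMap.congr_fun (hpow k) y⟩
  have hle : LinearMap.range (h ^ k) ≤ V := by
    obtain ⟨k, rfl⟩ := Nat.exists_eq_add_of_le' hk1
    rw [pow_succ']
    rintro _ ⟨y, rfl⟩
    exact (g _).2
  refine eq_top_iff.mpr fun x _ => hle ?_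
  have hnot := hmin _ hmem
  rw [lt_iff_le_and_ne, not_and, not_not] at hnot
  have heq := hnot (Submodule.map_subtype_le _ _)
  have hx : (x : Fin n → B) ∈ (LinearMap.range (h ^ k)).map P.subtype := by
    rw [heq]
    exact x.2
  obtain ⟨y, hy, hyx⟩ := hx
  exact (Subtype.ext hyx : y = x) ▸ hy

/-- A map from a reduced module to a finitely generated projective module has its image in the
radical: otherwise, composed with a suitable map to the projective cover of a simple module, it
would be a split epimorphism onto a non-zero projective module. -/
theorem range_le_jacobson_of_isReducedModule {M : ModuleCat.{u} B} (hM : IsReducedModule M)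
    {P : Type u} [AddCommGroup P] [Module B P] [Module.Finite B P] [Module.Projective B P]
    (h : M →ₗ[B] P) : LinearMap.range h ≤ Module.jacobson B P := by
  refine le_sInf fun N (hN : IsCoatom N) => ?_
  by_contra hle
  obtain ⟨C, p, _, _, hp, hps⟩ := exists_projectiveCover (B := B) (P ⧸ N)
  obtain ⟨q, hq⟩ := Module.projective_lifting_property p N.mkQ hp
  have hsurj : Function.Surjective (p ∘ₗ (q ∘ₗ h)) := by
    rw [← LinearMap.comp_assoc, hq]
    intro x
    obtain ⟨y, rfl⟩ := N.mkQ_surjective x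
    obtain ⟨a, ha, b, ⟨m, rfl⟩, rfl⟩ := Submodule.mem_sup.mp
      ((hN.2 _ (left_lt_sup.mpr hle)).symm ▸ Submodule.mem_top (x := y))
    refine ⟨m, ?_⟩
    simpa using ha
  have hqh := surjective_of_comp_surjective_of_superfluous hps hsurj
  obtain ⟨s, hs⟩ := Module.projective_lifting_property (q ∘ₗ h) LinearMap.id hqh
  have hs' : ∀ x, q (h (s x)) = x := fun x => LinearMap.congr_fun hs x
  have hinj : Function.Injective s := Function.LeftInverse.injective (g := q ∘ₗ h) hs'
  have hbot := hM (LinearMap.range s) (LinearMap.ker (q ∘ₗ h))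
    (LinearMap.isCompl_of_proj (f := s.rangeRestrict ∘ₗ (q ∘ₗ h)) (by
      rintro ⟨_, x, rfl⟩
      exact Subtype.ext (congrArg s (hs' x))) |> fun hc => by
        rwa [LinearMap.ker_comp_of_ker_eq_bot] at hc
        exact LinearMap.ker_eq_bot.mpr fun a b hab => hinj (congrArg Subtype.val hab))
    (Module.Projective.of_equiv (LinearEquiv.ofInjective s hinj))
  refine hN.1 (eq_top_iff.mpr fun x _ => ?_)
  obtain ⟨c, hc⟩ := hp (N.mkQ x)
  have : s c = 0 := by simpa [hbot] using LinearMap.mem_range_self s c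
  have : c = 0 := hinj (this.trans s.map_zero.symm)
  subst this
  rw [map_zero] at hc
  simpa using hc.symm

end Artinian

/-! ### Minimal projective resolutions -/

section Resolution

variable {B : Type u} [Ring B]

theorem augmentation_surjective {M : ModuleCat.{u} B} (P : ProjectiveResolution M) :
    Function.Surjective (augmentation P) := by
  rw [← ModuleCat.epi_iff_surjective]
  unfold augmentation
  infer_instance

theorem exact_d_augmentation {M : ModuleCat.{u} B} (P : ProjectiveResolution M) :
    Function.Exact (P.complex.d 1 0) (augmentation P) := by
  refine (ShortComplex.ShortExact.moduleCat_exact_iff_function_exact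
    (ShortComplex.mk _ _ (d_comp_augmentation P))).mp ?_
  refine (ShortComplex.exact_iff_of_iso (ShortComplex.isoMk (Iso.refl _) (Iso.refl _)
    (HomologicalComplex.singleObjXSelf (ComplexShape.down ℕ) 0 M) ?_ ?_)).mp P.exact₀
  · simp
  · simp [augmentation]

theorem exact_d_succ {M : ModuleCat.{u} B} (P : ProjectiveResolution M) (n : ℕ) :
    Function.Exact (P.complex.d (n + 2) (n + 1)) (P.complex.d (n + 1) n) :=
  (ShortComplex.ShortExact.moduleCat_exact_iff_function_exact _).mp (P.exact_succ n)

/-- The projective resolution of `M` given by a complex `C` of projective modules and a map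
`e : C_0 ⟶ M` such that `⋯ ⟶ C_1 ⟶ C_0 ⟶ M ⟶ 0` is exact. -/
def resolutionOfExact {M : ModuleCat.{u} B} (C : ChainComplex (ModuleCat.{u} B) ℕ)
    (hC : ∀ n, Module.Projective B (C.X n)) (e : C.X 0 ⟶ M) (he : Function.Surjective e)
    (h0 : Function.Exact (C.d 1 0) e)
    (hs : ∀ n, Function.Exact (C.d (n + 2) (n + 1)) (C.d (n + 1) n)) :
    ProjectiveResolution M where
  complex := C
  projective n := (IsProjective.iff_projective (C.X n)).mp (hC n)
  π := (ChainComplex.toSingle₀Equiv _ _).symm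
    ⟨e, by ext x; exact h0.apply_apply_eq_zero x⟩
  quasiIso := ⟨fun n => by
    cases n with
    | zero =>
      rw [ChainComplex.quasiIsoAt₀_iff, ShortComplex.quasiIso_iff_of_zeros']
      · refine (ShortComplex.exact_and_epi_g_iff_of_iso
          (S₂ := ShortComplex.mk (C.d 1 0) e (by ext x; exact h0.apply_apply_eq_zero x)) ?_).2
          ⟨(ShortComplex.ShortExact.moduleCat_exact_iff_function_exact _).mpr h0,
            (ModuleCat.epi_iff_surjective _).mpr he⟩
        exact ShortComplex.isoMk (Iso.refl _) (Iso.refl _) (Iso.refl _)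
          ((Category.id_comp _).trans (Category.comp_id _).symm)
          ((Category.id_comp _).trans (Category.comp_id _).symm)
      · exact C.shape 0 0 (by simp)
      · rfl
      · rfl
    | succ n =>
      rw [quasiIsoAt_iff_exactAt', HomologicalComplex.exactAt_iff' _ (n + 2) (n + 1) n
        (by simp only [ChainComplex.prev]; rfl) (by simp)]
      · exact (ShortComplex.ShortExact.moduleCat_exact_iff_function_exact _).mpr (hs n)
      · apply ChainComplex.exactAt_succ_single_obj⟩

@[simp]
theorem augmentation_resolutionOfExact {M : ModuleCat.{u} B}
    (C : ChainComplex (ModuleCat.{u} B) ℕ)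
    (hC : ∀ n, Module.Projective B (C.X n)) (e : C.X 0 ⟶ M) (he : Function.Surjective e)
    (h0 : Function.Exact (C.d 1 0) e)
    (hs : ∀ n, Function.Exact (C.d (n + 2) (n + 1)) (C.d (n + 1) n)) :
    augmentation (resolutionOfExact C hC e he h0 hs) = e := by
  simp [augmentation, resolutionOfExact, ChainComplex.toSingle₀Equiv]

/-- As radicals of finitely generated modules are superfluous, a resolution by modules of finite
length is minimal if and only if its differentials have their images in the radicals. -/
theorem isMinimalResolution_iff [IsArtinianRing B] {M : ModuleCat.{u} B}
    (P : ProjectiveResolution M) :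
    IsMinimalResolution P ↔ (∀ n, Module.Finite B (P.complex.X n)) ∧
      ∀ n, LinearMap.range (P.complex.d (n + 1) n).hom ≤ Module.jacobson B (P.complex.X n) := by
  have h0 := LinearMap.exact_iff.mp (exact_d_augmentation P)
  have hs := fun n => LinearMap.exact_iff.mp (exact_d_succ P n)
  simp only [IsMinimalResolution, isFiniteLength_iff_finite]
  refine and_congr_right fun hfin => ⟨fun h n => ?_, fun h => ⟨fun U hU => ?_, fun n U hU => ?_⟩⟩
  · cases n with
    | zero => exact h0 ▸ le_jacobson_of_superfluous h.1
    | succ n => exact hs n ▸ le_jacobson_of_superfluous (h.2 n)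
  · have := hfin 0
    exact eq_top_of_sup_eq_top_of_le_jacobson (h0 ▸ h 0) hU
  · have := hfin (n + 1)
    exact eq_top_of_sup_eq_top_of_le_jacobson (hs n ▸ h (n + 1)) hU

section Existence

variable [IsArtinianRing B]

theorem exists_cover_ker {X Y : ModuleCat.{u} B} (f : X ⟶ Y) :
    ∃ (C : ModuleCat.{u} B) (p : C ⟶ X), Module.Finite B X →
      Module.Finite B C ∧ Module.Projective B C ∧ Function.Exact p f ∧
        HasSuperfluousKernel p := by
  by_cases hX : Module.Finite B X
  · have : Module.Finite B (LinearMap.ker f.hom) := inferInstance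
    obtain ⟨C, p, h1, h2, h3, h4⟩ := exists_projectiveCover (B := B) (LinearMap.ker f.hom)
    refine ⟨C, ModuleCat.ofHom ((LinearMap.ker f.hom).subtype ∘ₗ p), fun _ => ⟨h1, h2, ?_, ?_⟩⟩
    · refine LinearMap.exact_iff.mpr ?_
      change _ = LinearMap.range ((LinearMap.ker f.hom).subtype ∘ₗ p)
      rw [LinearMap.range_comp_of_range_eq_top _ (LinearMap.range_eq_top.mpr h3),
        Submodule.range_subtype]
    · intro U hU
      refine h4 U ?_
      rwa [ModuleCat.hom_ofHom, LinearMap.ker_comp_of_ker_eq_bot _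
        (Submodule.ker_subtype _)] at hU
  · exact ⟨X, 0, fun h => absurd h hX⟩

/-- The maps of a minimal projective resolution of `M`: the first one is a projective cover of `M`,
with `M` written as the kernel of `0 : M ⟶ M`, and each one is followed by a projective cover of its
kernel. -/
def minimalSequence (M : ModuleCat.{u} B) : ℕ → Σ (X Y : ModuleCat.{u} B), X ⟶ Y
  | 0 => ⟨_, M, (exists_cover_ker (0 : M ⟶ M)).choose_spec.choose⟩
  | n + 1 => ⟨_, (minimalSequence M n).1,
      (exists_cover_ker (minimalSequence M n).2.2).choose_spec.choose⟩

theorem minimalSequence_finite_projective (M : ModuleCat.{u} B) [Module.Finite B M] (n : ℕ) :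
    Module.Finite B (minimalSequence M n).1 ∧ Module.Projective B (minimalSequence M n).1 := by
  induction n with
  | zero =>
    obtain ⟨h1, h2, -⟩ := (exists_cover_ker (0 : M ⟶ M)).choose_spec.choose_spec ‹_›
    exact ⟨h1, h2⟩
  | succ n ih =>
    obtain ⟨h1, h2, -⟩ :=
      (exists_cover_ker (minimalSequence M n).2.2).choose_spec.choose_spec ih.1
    exact ⟨h1, h2⟩

theorem exists_isMinimalResolution (M : ModuleCat.{u} B) [Module.Finite B M] :
    ∃ P : ProjectiveResolution M, IsMinimalResolution P := by
  have hfp := minimalSequence_finite_projective M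
  let X : ℕ → ModuleCat.{u} B := fun n => (minimalSequence M n).1
  let e : X 0 ⟶ M := (minimalSequence M 0).2.2
  let d : ∀ n, X (n + 1) ⟶ X n := fun n => (minimalSequence M (n + 1)).2.2
  have he : Function.Exact e (0 : M ⟶ M) ∧ HasSuperfluousKernel e :=
    ((exists_cover_ker (0 : M ⟶ M)).choose_spec.choose_spec ‹_›).2.2
  have hd0 : Function.Exact (d 0) e ∧ HasSuperfluousKernel (d 0) :=
    ((exists_cover_ker (minimalSequence M 0).2.2).choose_spec.choose_spec (hfp 0).1).2.2
  have hd : ∀ n, Function.Exact (d (n + 1)) (d n) ∧ HasSuperfluousKernel (d (n + 1)) := fun n =>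
    ((exists_cover_ker (minimalSequence M (n + 1)).2.2).choose_spec.choose_spec
      (hfp (n + 1)).1).2.2
  have hsurj : Function.Surjective e := fun x => (he.1 x).mp rfl
  let C : ChainComplex (ModuleCat.{u} B) ℕ :=
    ChainComplex.of X d fun n => by ext x; exact (hd n).1.apply_apply_eq_zero x
  have hCd : ∀ n, C.d (n + 1) n = d n := fun n => ChainComplex.of_d _ _ n
  refine ⟨resolutionOfExact C (fun n => (hfp n).2) e hsurj
    ((hCd 0).symm ▸ hd0.1) (fun n => (hCd n).symm ▸ (hCd (n + 1)).symm ▸ (hd n).1),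
    fun n => isFiniteLength_iff_finite.mpr (hfp n).1, ?_, fun n => ?_⟩
  · exact (congrArg HasSuperfluousKernel (augmentation_resolutionOfExact ..)).mpr he.2
  · change HasSuperfluousKernel (C.d (n + 1) n)
    rw [hCd]
    cases n with
    | zero => exact hd0.2
    | succ n => exact (hd n).2

end Existence

section Uniqueness

variable [IsArtinianRing B]

theorem bijective_of_sub_id_range_le_jacobson {M : Type*} [AddCommGroup M] [Module B M]
    [Module.Finite B M] (f : M →ₗ[B] M)
    (hf : ∀ x, x - f x ∈ Module.jacobson B M) : Function.Bijective f := by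
  refine IsNoetherian.bijective_of_surjective_endomorphism f (LinearMap.range_eq_top.mp
    (eq_top_of_sup_eq_top_of_le_jacobson (le_refl (Module.jacobson B M)) ?_))
  refine eq_top_iff.mpr fun x _ => ?_
  exact Submodule.mem_sup.mpr ⟨f x, ⟨x, rfl⟩, x - f x, hf x, by abel⟩

theorem isIso_f_of_homotopy_id {M : ModuleCat.{u} B} {P : ProjectiveResolution M}
    (hP : IsMinimalResolution P) {f : P.complex ⟶ P.complex} (h : Homotopy f (𝟙 P.complex))
    (n : ℕ) : IsIso (f.f n) := by
  obtain ⟨hfin, hrad⟩ := (isMinimalResolution_iff P).mp hP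
  have := hfin n
  have : Function.Bijective (f.f n) := by
    refine bijective_of_sub_id_range_le_jacobson (f.f n).hom fun x => ?_
    have hx : f.f n x = (dNext n h.hom) x + (prevD n h.hom) x + x := by
      have := congrArg (fun g => g x) (congrArg ModuleCat.Hom.hom (h.comm n))
      simpa using this
    have hnext : dNext n h.hom x ∈ Module.jacobson B (P.complex.X n) := by
      cases n with
      | zero => simp
      | succ n =>
        rw [dNext_eq h.hom (ComplexShape.down_mk _ n rfl)]
        exact Module.map_jacobson_le (h.hom n (n + 1)).hom ⟨_, hrad n ⟨x, rfl⟩, rfl⟩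
    have hprev : prevD n h.hom x ∈ Module.jacobson B (P.complex.X n) := by
      rw [prevD_eq h.hom (ComplexShape.down_mk _ n rfl)]
      exact hrad n ⟨_, rfl⟩
    change x - f.f n x ∈ _
    rw [hx]
    convert neg_mem (add_mem hnext hprev) using 1
    abel
  exact (ConcreteCategory.isIso_iff_bijective _).mpr this

/-- Minimal projective resolutions are unique: a lift of an isomorphism is an isomorphism. Its
composition with a lift of the inverse is homotopic to the identity, and by minimality the
difference to the identity has its image in the radical. -/
theorem isIso_lift {M N : ModuleCat.{u} B} (e : M ≅ N) {P : ProjectiveResolution M}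
    {Q : ProjectiveResolution N} (hP : IsMinimalResolution P) (hQ : IsMinimalResolution Q)
    (n : ℕ) : IsIso ((ProjectiveResolution.lift e.hom P Q).f n) := by
  have h1 : Homotopy (ProjectiveResolution.lift e.hom P Q ≫ ProjectiveResolution.lift e.inv Q P)
      (𝟙 P.complex) := (ProjectiveResolution.liftCompHomotopy e.hom e.inv P Q P).symm.trans <| by
    simpa using ProjectiveResolution.liftIdHomotopy M P
  have h2 : Homotopy (ProjectiveResolution.lift e.inv Q P ≫ ProjectiveResolution.lift e.hom P Q)
      (𝟙 Q.complex) := (ProjectiveResolution.liftCompHomotopy e.inv e.hom Q P Q).symm.trans <| by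
    simpa using ProjectiveResolution.liftIdHomotopy N Q
  have i1 := (ConcreteCategory.isIso_iff_bijective _).mp (isIso_f_of_homotopy_id hP h1 n)
  have i2 := (ConcreteCategory.isIso_iff_bijective _).mp (isIso_f_of_homotopy_id hQ h2 n)
  rw [HomologicalComplex.comp_f] at i1 i2
  refine (ConcreteCategory.isIso_iff_bijective _).mpr ⟨?_, ?_⟩
  · exact Function.Injective.of_comp (f := (ProjectiveResolution.lift e.inv Q P).f n)
      (by simpa using i1.1)
  · exact Function.Surjective.of_comp (g := (ProjectiveResolution.lift e.inv Q P).f n)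
      (by simpa using i2.2)

end Uniqueness

theorem lift_augmentation {M N : ModuleCat.{u} B} (f : M ⟶ N) (P : ProjectiveResolution M)
    (Q : ProjectiveResolution N) :
    (ProjectiveResolution.lift f P Q).f 0 ≫ augmentation Q = augmentation P ≫ f := by
  have h := ProjectiveResolution.lift_commutes_zero f P Q
  simp only [augmentation]
  rw [← Category.assoc, h]
  rfl

/-- `Ext^i(M, Y) = 0` for all `i ≥ 1` if and only if the complex `Hom(P_•, Y)` is exact in all
positive degrees. -/
theorem subsingleton_ext_iff {M : ModuleCat.{u} B} (P : ProjectiveResolution M)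
    (Y : ModuleCat.{u} B) :
    (∀ i : ℕ, 1 ≤ i → Subsingleton (Abelian.Ext M Y i)) ↔
      ∀ (n : ℕ) (f : P.complex.X (n + 1) ⟶ Y), P.complex.d (n + 2) (n + 1) ≫ f = 0 →
        ∃ g : P.complex.X n ⟶ Y, P.complex.d (n + 1) n ≫ g = f := by
  refine ⟨fun h n f hf => ?_, fun h i hi => ?_⟩
  · have := h (n + 1) (by omega)
    exact (P.extMk_eq_zero_iff f (n + 2) rfl hf n rfl).mp (Subsingleton.elim _ _)
  · obtain ⟨n, rfl⟩ := Nat.exists_eq_add_of_le' hi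
    refine subsingleton_of_forall_eq 0 fun α => ?_
    obtain ⟨f, hf, rfl⟩ := P.extMk_surjective α (n + 2) rfl
    exact (P.extMk_eq_zero_iff f (n + 2) rfl hf n rfl).mpr (h n f hf)

end Resolution

/-! ### Duality with respect to a regular bimodule -/

/-- An abelian group `D` with commuting actions of `B` and `C` is a regular bimodule with generator
`e` if it is free of rank one with basis `e` for both actions. The ring `A` with its left and right
multiplications is an example, and the notion is symmetric in `B` and `C`; in this way the facts
about the `A`-duals of left modules and of right modules are proved together. -/
structure IsRegularBimodule (B C : Type*) {D : Type*} [Ring B] [Ring C] [AddCommGroup D]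
    [Module B D] [Module C D] (e : D) : Prop where
  bijective_left : Function.Bijective (fun b : B => b • e)
  bijective_right : Function.Bijective (fun c : C => c • e)

namespace IsRegularBimodule

variable {B C D : Type*} [Ring B] [Ring C] [AddCommGroup D] [Module B D] [Module C D] {e : D}

theorem symm (h : IsRegularBimodule B C e) : IsRegularBimodule C B e :=
  ⟨h.bijective_right, h.bijective_left⟩

/-- The coordinate of an element of `D` with respect to the basis `e` of the `B`-module `D`. -/
def coord (h : IsRegularBimodule B C e) : D ≃ₗ[B] B :=
  (LinearEquiv.ofBijective (LinearMap.toSpanSingleton B D e) h.bijective_left).symm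

theorem coord_smul (h : IsRegularBimodule B C e) (x : D) : h.coord x • e = x :=
  (LinearEquiv.ofBijective (LinearMap.toSpanSingleton B D e) h.bijective_left).apply_symm_apply x

variable {M : Type*} [AddCommGroup M] [Module B M]

theorem exists_dualBasis (h : IsRegularBimodule B C e) [Module.Finite B M]
    [Module.Projective B M] :
    ∃ (n : ℕ) (a : Fin n → M) (f : Fin n → M →ₗ[B] D), ∀ m, ∑ i, h.coord (f i m) • a i = m := by
  obtain ⟨n, q, hq⟩ := Module.Finite.exists_fin' B M
  obtain ⟨s, hs⟩ := Module.projective_lifting_property q LinearMap.id hq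
  refine ⟨n, fun i => q (Pi.single i 1), fun i => h.coord.symm.toLinearMap ∘ₗ
    LinearMap.proj i ∘ₗ s, fun m => ?_⟩
  conv_rhs => rw [← LinearMap.id_apply (R := B) m, ← hs, LinearMap.comp_apply,
    pi_eq_sum_univ' (s m), map_sum]
  simp

section Comm

variable [SMulCommClass B C D]

theorem coord_smul_comm (h : IsRegularBimodule B C e) (x y : D) :
    h.coord x • y = h.symm.coord y • x := by
  conv_lhs => rw [← h.symm.coord_smul y, smul_comm, h.coord_smul]

theorem sum_dualBasis (h : IsRegularBimodule B C e) {n : ℕ} {a : Fin n → M}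
    {f : Fin n → M →ₗ[B] D} (hf : ∀ m, ∑ i, h.coord (f i m) • a i = m) (g : M →ₗ[B] D) :
    ∑ i, h.symm.coord (g (a i)) • f i = g := by
  ext m
  conv_rhs => rw [← hf m, map_sum]
  simp only [LinearMap.sum_apply, LinearMap.smul_apply, map_smul, h.coord_smul_comm]

theorem finite_dual (h : IsRegularBimodule B C e) [IsNoetherianRing C] [Module.Finite B M] :
    Module.Finite C (M →ₗ[B] D) := by
  obtain ⟨n, q, hq⟩ := Module.Finite.exists_fin' B M
  have : IsNoetherian C D := isNoetherian_of_linearEquiv h.symm.coord.symm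
  refine Module.Finite.of_injective
    (LinearMap.pi fun i : Fin n => LinearMap.applyₗ' C (M := M) (M₂ := D) (q (Pi.single i 1)))
    fun f g hfg => ?_
  refine (LinearMap.cancel_right hq).mp (LinearMap.pi_ext' fun i => LinearMap.ext_ring ?_)
  exact congrFun hfg i

theorem finite_dual_of_projective (h : IsRegularBimodule B C e) [Module.Finite B M]
    [Module.Projective B M] : Module.Finite C (M →ₗ[B] D) := by
  obtain ⟨n, a, f, hf⟩ := h.exists_dualBasis (M := M)
  refine Module.Finite.of_surjective (Fintype.linearCombination C f) fun g =>
    ⟨fun i => h.symm.coord (g (a i)), ?_⟩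
  rw [Fintype.linearCombination_apply, h.sum_dualBasis hf]

theorem projective_dual (h : IsRegularBimodule B C e) [Module.Finite B M]
    [Module.Projective B M] : Module.Projective C (M →ₗ[B] D) := by
  obtain ⟨n, a, f, hf⟩ := h.exists_dualBasis (M := M)
  let c : (M →ₗ[B] D) →ₗ[C] Fin n → C :=
    LinearMap.pi fun i => h.symm.coord.toLinearMap ∘ₗ LinearMap.applyₗ' C (a i)
  refine Module.Projective.of_split c
    (Fintype.linearCombination C f) (LinearMap.ext fun g => ?_)
  rw [LinearMap.comp_apply, Fintype.linearCombination_apply]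
  exact h.sum_dualBasis hf g

theorem bijective_eval (h : IsRegularBimodule B C e) [Module.Finite B M]
    [Module.Projective B M] :
    (∀ m : M, (∀ f : M →ₗ[B] D, f m = 0) → m = 0) ∧
      ∀ F : (M →ₗ[B] D) →ₗ[C] D, ∃ m : M, ∀ f, f m = F f := by
  obtain ⟨n, a, f, hf⟩ := h.exists_dualBasis (M := M)
  refine ⟨fun m hm => ?_, fun F => ⟨∑ i, h.coord (F (f i)) • a i, fun g => ?_⟩⟩
  · rw [← hf m]
    simp [hm]
  · conv_rhs => rw [← h.sum_dualBasis hf g, map_sum]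
    simp only [map_sum, map_smul, h.coord_smul_comm]

variable [SMulCommClass C B D]

/-- The two radicals of a regular bimodule agree: an element `x` of the radical of the `B`-module
`D` is in every maximal `C`-submodule `N`. Otherwise `e = n + c x` with `n ∈ N`, and then `n`
generates the `B`-module `D`, hence also the `C`-module `D`. -/
theorem mem_jacobson (h : IsRegularBimodule B C e) [IsNoetherian B D] {x : D}
    (hx : x ∈ Module.jacobson B D) : x ∈ Module.jacobson C D := by
  refine Submodule.mem_sInf.mpr fun N (hN : IsCoatom N) => ?_
  by_contra hxN
  have htop : N ⊔ Submodule.span C {x} = ⊤ := hN.2 _ (left_lt_sup.mpr fun hle =>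
    hxN (hle (Submodule.mem_span_singleton_self x)))
  obtain ⟨n, hn, y, hy, hny⟩ := Submodule.mem_sup.mp (htop.symm ▸ Submodule.mem_top (x := e))
  obtain ⟨c, rfl⟩ := Submodule.mem_span_singleton.mp hy
  -- multiplication by `c` is an endomorphism of the `B`-module `D`
  have hcx : c • x ∈ Module.jacobson B D :=
    Module.map_jacobson_le (Module.toModuleEnd B (S := C) D c) ⟨x, hx, rfl⟩
  have hspan : Submodule.span B {n} = ⊤ := by
    refine eq_top_of_sup_eq_top_of_le_jacobson (le_refl (Module.jacobson B D))
      (eq_top_iff.mpr fun z _ => ?_)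
    rw [← h.coord_smul z]
    refine Submodule.smul_mem _ _ (hny ▸ add_mem ?_ ?_)
    · exact Submodule.mem_sup_left (Submodule.mem_span_singleton_self n)
    · exact Submodule.mem_sup_right hcx
  -- the endomorphism `e ↦ n` of the noetherian `B`-module `D` is surjective, hence injective
  let f : D →ₗ[B] D := Module.toModuleEnd B (S := C) D (h.symm.coord n)
  have hfe : f e = n := h.symm.coord_smul n
  have hf : Function.Injective f := by
    refine IsNoetherian.injective_of_surjective_endomorphism f (LinearMap.range_eq_top.mp ?_)
    rw [eq_top_iff, ← hspan, Submodule.span_singleton_le_iff_mem]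
    exact ⟨e, hfe⟩
  obtain ⟨b, hb⟩ := Submodule.mem_span_singleton.mp (hspan.symm ▸ Submodule.mem_top (x := e))
  have hbn : h.coord n • b • e = e := by
    refine hf ?_
    rw [map_smul, map_smul, hfe, hb, h.coord_smul]
  refine hN.1 (eq_top_iff.mpr fun z _ => ?_)
  have he : h.symm.coord (b • e) • n = e := by rw [← h.coord_smul_comm, hbn]
  have heN : e ∈ N := he ▸ N.smul_mem _ hn
  exact h.symm.coord_smul z ▸ N.smul_mem (h.symm.coord z) heN

/-- The dual of a map with image in the radical has its image in the radical: with a dual basis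
`(a_i, f_i)`, a map `g` with values in the radical of `D` is a combination of the `f_i` with
coefficients in the radical. -/
theorem mem_jacobson_dual (h : IsRegularBimodule B C e) [IsNoetherian B D] [Module.Finite B M]
    [Module.Projective B M] {g : M →ₗ[B] D} (hg : ∀ m, g m ∈ Module.jacobson B D) :
    g ∈ Module.jacobson C (M →ₗ[B] D) := by
  obtain ⟨n, a, f, hf⟩ := h.exists_dualBasis (M := M)
  rw [← h.sum_dualBasis hf g]
  refine sum_mem fun i _ => ?_
  exact Module.map_jacobson_le ((LinearMap.toSpanSingleton C (M →ₗ[B] D) (f i)) ∘ₗ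
    h.symm.coord.toLinearMap) ⟨_, h.mem_jacobson (hg (a i)), rfl⟩

end Comm

end IsRegularBimodule

section Dual

variable {A : Type u} [Ring A]

theorem isRegularBimodule_self : IsRegularBimodule A Aᵐᵒᵖ (1 : A) where
  bijective_left := by simpa using! Function.bijective_id
  bijective_right := by simpa using MulOpposite.unop_bijective

section Projective

instance finite_dual_of_projective (M : ModuleCat.{u} A) [Module.Finite A M]
    [Module.Projective A M] : Module.Finite Aᵐᵒᵖ (dual M) :=
  isRegularBimodule_self.finite_dual_of_projective

instance projective_dual (M : ModuleCat.{u} A) [Module.Finite A M]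
    [Module.Projective A M] : Module.Projective Aᵐᵒᵖ (dual M) :=
  isRegularBimodule_self.projective_dual

instance finite_dualRight_of_projective (N : ModuleCat.{u} Aᵐᵒᵖ) [Module.Finite Aᵐᵒᵖ N]
    [Module.Projective Aᵐᵒᵖ N] : Module.Finite A (dualRight N) :=
  isRegularBimodule_self.symm.finite_dual_of_projective

instance projective_dualRight (N : ModuleCat.{u} Aᵐᵒᵖ) [Module.Finite Aᵐᵒᵖ N]
    [Module.Projective Aᵐᵒᵖ N] : Module.Projective A (dualRight N) :=
  isRegularBimodule_self.symm.projective_dual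

theorem phi_bijective (M : ModuleCat.{u} A) [Module.Finite A M] [Module.Projective A M] :
    Function.Bijective (phi M) := by
  obtain ⟨h1, h2⟩ := isRegularBimodule_self.bijective_eval (B := A) (C := Aᵐᵒᵖ) (M := M)
  refine ⟨(injective_iff_map_eq_zero (phi M).hom).mpr fun m hm =>
    h1 m fun f => LinearMap.congr_fun hm f, fun F => ?_⟩
  obtain ⟨m, hm⟩ := h2 F
  exact ⟨m, LinearMap.ext hm⟩

theorem phiRight_bijective (N : ModuleCat.{u} Aᵐᵒᵖ) [Module.Finite Aᵐᵒᵖ N]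
    [Module.Projective Aᵐᵒᵖ N] : Function.Bijective (phiRight N) := by
  obtain ⟨h1, h2⟩ := isRegularBimodule_self.symm.bijective_eval (B := Aᵐᵒᵖ) (C := A) (M := N)
  refine ⟨(injective_iff_map_eq_zero (phiRight N).hom).mpr fun m hm =>
    h1 m fun f => LinearMap.congr_fun hm f, fun F => ?_⟩
  obtain ⟨m, hm⟩ := h2 F
  exact ⟨m, LinearMap.ext hm⟩

theorem range_dualMap_le_jacobson [IsNoetherianRing A] {M M' : ModuleCat.{u} A} (f : M ⟶ M')
    [Module.Finite A M] [Module.Projective A M]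
    (hf : LinearMap.range f.hom ≤ Module.jacobson A M') :
    LinearMap.range (dualMap f).hom ≤ Module.jacobson Aᵐᵒᵖ (dual M) := by
  rintro _ ⟨g, rfl⟩
  exact isRegularBimodule_self.mem_jacobson_dual fun m =>
    Module.map_jacobson_le (g : M' →ₗ[A] A) ⟨_, hf ⟨m, rfl⟩, rfl⟩

theorem range_dualRightMap_le_jacobson [IsNoetherianRing Aᵐᵒᵖ] {N N' : ModuleCat.{u} Aᵐᵒᵖ}
    (f : N ⟶ N') [Module.Finite Aᵐᵒᵖ N] [Module.Projective Aᵐᵒᵖ N]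
    (hf : LinearMap.range f.hom ≤ Module.jacobson Aᵐᵒᵖ N') :
    LinearMap.range (dualRightMap f).hom ≤ Module.jacobson A (dualRight N) := by
  have : IsNoetherian Aᵐᵒᵖ A :=
    isNoetherian_of_linearEquiv (isRegularBimodule_self (A := A)).symm.coord.symm
  rintro _ ⟨g, rfl⟩
  exact isRegularBimodule_self.symm.mem_jacobson_dual fun m =>
    Module.map_jacobson_le (g : N' →ₗ[Aᵐᵒᵖ] A) ⟨_, hf ⟨m, rfl⟩, rfl⟩

end Projective

theorem finite_dual [IsNoetherianRing Aᵐᵒᵖ] (M : ModuleCat.{u} A) [Module.Finite A M] :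
    Module.Finite Aᵐᵒᵖ (dual M) :=
  isRegularBimodule_self.finite_dual

end Dual

/-! ### Exactness of complexes and of their duals -/

section Exactness

variable {A : Type u} [Ring A]

theorem isZero_homology_iff (P : ChainComplex (ModuleCat.{u} A) ℤ) (j : ℤ) :
    IsZero (P.homology (j + 1)) ↔ Function.Exact (P.d (j + 1 + 1) (j + 1)) (P.d (j + 1) j) := by
  rw [← HomologicalComplex.exactAt_iff_isZero_homology,
    HomologicalComplex.exactAt_iff' _ (j + 1 + 1) (j + 1) j (by simp) (by simp)]
  exact ShortComplex.ShortExact.moduleCat_exact_iff_function_exact _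

theorem acyclic_dualComplex_iff (P : ChainComplex (ModuleCat.{u} A) ℤ) :
    (dualComplex P).Acyclic ↔ ∀ j : ℤ, Function.Exact (dualMap (P.d (j + 1) j))
      (dualMap (P.d (j + 1 + 1) (j + 1))) := by
  have key : ∀ j : ℤ, (dualComplex P).ExactAt (j + 1) ↔
      Function.Exact (dualMap (P.d (j + 1) j)) (dualMap (P.d (j + 1 + 1) (j + 1))) := fun j => by
    rw [HomologicalComplex.exactAt_iff' _ j (j + 1) (j + 1 + 1) (by simp) (by simp)]
    exact ShortComplex.ShortExact.moduleCat_exact_iff_function_exact _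
  refine ⟨fun h j => (key j).mp (h _), fun h i => ?_⟩
  have := (key (i - 1)).mpr (h _)
  rwa [sub_add_cancel] at this

theorem exact_dualMap_iff {X Y Z : ModuleCat.{u} A} (f : X ⟶ Y) (g : Y ⟶ Z) :
    Function.Exact (dualMap g) (dualMap f) ↔
      ∀ h : Y →ₗ[A] A, h ∘ₗ f.hom = 0 ↔ ∃ k : Z →ₗ[A] A, k ∘ₗ g.hom = h :=
  Iff.rfl

theorem exact_dualRightMap_iff {X Y Z : ModuleCat.{u} Aᵐᵒᵖ} (f : X ⟶ Y) (g : Y ⟶ Z) :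
    Function.Exact (dualRightMap g) (dualRightMap f) ↔
      ∀ h : Y →ₗ[Aᵐᵒᵖ] A, h ∘ₗ f.hom = 0 ↔ ∃ k : Z →ₗ[Aᵐᵒᵖ] A, k ∘ₗ g.hom = h :=
  Iff.rfl

theorem subsingleton_ext_iff_linear {B : Type u} [Ring B] {D : Type u} [AddCommGroup D]
    [Module B D] {M : ModuleCat.{u} B} (P : ProjectiveResolution M) :
    (∀ i : ℕ, 1 ≤ i → Subsingleton (Abelian.Ext M (ModuleCat.of B D) i)) ↔
      ∀ (n : ℕ) (h : P.complex.X (n + 1) →ₗ[B] D),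
        h ∘ₗ (P.complex.d (n + 2) (n + 1)).hom = 0 ↔
          ∃ k : P.complex.X n →ₗ[B] D, k ∘ₗ (P.complex.d (n + 1) n).hom = h := by
  rw [subsingleton_ext_iff P]
  refine forall_congr' fun n => ⟨fun H h => ⟨fun h0 => ?_, ?_⟩, fun H f hf => ?_⟩
  · obtain ⟨g, hg⟩ := H (ModuleCat.ofHom h) (ModuleCat.hom_ext h0)
    exact ⟨g.hom, congrArg ModuleCat.Hom.hom hg⟩
  · rintro ⟨k, rfl⟩
    rw [LinearMap.comp_assoc, ← ModuleCat.hom_comp, P.complex.d_comp_d, ModuleCat.hom_zero,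
      LinearMap.comp_zero]
  · obtain ⟨k, hk⟩ := (H f.hom).mp (congrArg ModuleCat.Hom.hom hf)
    exact ⟨ModuleCat.ofHom k, ModuleCat.hom_ext hk⟩

/-- `M` is semi-Gorenstein-projective if and only if the dual of a projective resolution of `M` is
exact in all positive degrees. -/
theorem isSemiGorensteinProjective_iff {M : ModuleCat.{u} A} (P : ProjectiveResolution M) :
    IsSemiGorensteinProjective M ↔ ∀ n : ℕ, Function.Exact (dualMap (P.complex.d (n + 1) n))
      (dualMap (P.complex.d (n + 2) (n + 1))) :=
  subsingleton_ext_iff_linear P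

theorem isSemiGorensteinProjectiveRight_iff {N : ModuleCat.{u} Aᵐᵒᵖ}
    (P : ProjectiveResolution N) :
    IsSemiGorensteinProjectiveRight N ↔ ∀ n : ℕ,
      Function.Exact (dualRightMap (P.complex.d (n + 1) n))
        (dualRightMap (P.complex.d (n + 2) (n + 1))) :=
  subsingleton_ext_iff_linear P

theorem dualMap_injective {X Y : ModuleCat.{u} A} {f : X ⟶ Y} (hf : Function.Surjective f) :
    Function.Injective (dualMap f) := fun g h hgh =>
  LinearMap.ext fun y => by
    obtain ⟨x, rfl⟩ := hf y
    exact LinearMap.congr_fun (f := g ∘ₗ f.hom) (g := h ∘ₗ f.hom) hgh x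

theorem dualRightMap_injective {X Y : ModuleCat.{u} Aᵐᵒᵖ} {f : X ⟶ Y}
    (hf : Function.Surjective f) : Function.Injective (dualRightMap f) := fun g h hgh =>
  LinearMap.ext fun y => by
    obtain ⟨x, rfl⟩ := hf y
    exact LinearMap.congr_fun (f := g ∘ₗ f.hom) (g := h ∘ₗ f.hom) hgh x

theorem exists_factor_of_exact {B : Type*} [Ring B] {X Y Z D : Type*} [AddCommGroup X]
    [AddCommGroup Y] [AddCommGroup Z] [AddCommGroup D] [Module B X] [Module B Y] [Module B Z]
    [Module B D] {f : X →ₗ[B] Y} {g : Y →ₗ[B] Z} (hfg : Function.Exact f g)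
    (hg : Function.Surjective g) {h : Y →ₗ[B] D} (hh : h ∘ₗ f = 0) :
    ∃ k : Z →ₗ[B] D, k ∘ₗ g = h := by
  have hle : LinearMap.ker g ≤ LinearMap.ker h := fun y hy => by
    obtain ⟨x, rfl⟩ := (hfg y).mp hy
    exact LinearMap.congr_fun hh x
  refine ⟨(LinearMap.ker g).liftQ h hle ∘ₗ
    (g.quotKerEquivOfSurjective hg).symm.toLinearMap, LinearMap.ext fun y => ?_⟩
  have : (g.quotKerEquivOfSurjective hg).symm (g y) = (LinearMap.ker g).mkQ y := by
    rw [LinearEquiv.symm_apply_eq]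
    rfl
  simp only [LinearMap.comp_apply, LinearEquiv.coe_coe, this]
  rfl

theorem exact_dualMap_of_exact {X Y Z : ModuleCat.{u} A} {f : X ⟶ Y} {g : Y ⟶ Z}
    (hfg : Function.Exact f g) (hg : Function.Surjective g) :
    Function.Exact (dualMap g) (dualMap f) := by
  refine (exact_dualMap_iff f g).mpr fun h => ⟨exists_factor_of_exact hfg hg, ?_⟩
  rintro ⟨k, rfl⟩
  exact LinearMap.ext fun x => (congrArg k (hfg.apply_apply_eq_zero x)).trans k.map_zero

theorem exact_dualRightMap_of_exact {X Y Z : ModuleCat.{u} Aᵐᵒᵖ} {f : X ⟶ Y} {g : Y ⟶ Z}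
    (hfg : Function.Exact f g) (hg : Function.Surjective g) :
    Function.Exact (dualRightMap g) (dualRightMap f) := by
  refine (exact_dualRightMap_iff f g).mpr fun h => ⟨exists_factor_of_exact hfg hg, ?_⟩
  rintro ⟨k, rfl⟩
  exact LinearMap.ext fun x => (congrArg k (hfg.apply_apply_eq_zero x)).trans k.map_zero

/-- Exactness can be tested after replacing the three modules by isomorphic ones. -/
theorem exact_iff_of_bijective {B : Type*} [Ring B] {X Y Z X' Y' Z' : ModuleCat.{u} B}
    {f : X ⟶ Y} {g : Y ⟶ Z} {f' : X' ⟶ Y'} {g' : Y' ⟶ Z'} {a : X ⟶ X'} {b : Y ⟶ Y'} {c : Z ⟶ Z'}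
    (ha : Function.Bijective a) (hb : Function.Bijective b) (hc : Function.Bijective c)
    (h1 : f ≫ b = a ≫ f') (h2 : g ≫ c = b ≫ g') :
    Function.Exact f' g' ↔ Function.Exact f g := by
  have e1 : ∀ x, b (f x) = f' (a x) := fun x => ConcreteCategory.congr_hom h1 x
  have e2 : ∀ x, c (g x) = g' (b x) := fun x => ConcreteCategory.congr_hom h2 x
  refine ⟨fun h y => ?_, fun h y => ?_⟩
  · rw [← map_eq_zero_iff _ hc.1, e2, h (b y)]
    refine ⟨?_, ?_⟩
    · rintro ⟨x, hx⟩
      obtain ⟨x, rfl⟩ := ha.2 x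
      exact ⟨x, hb.1 ((e1 x).trans hx)⟩
    · rintro ⟨x, rfl⟩
      exact ⟨a x, (e1 x).symm⟩
  · obtain ⟨y, rfl⟩ := hb.2 y
    rw [← e2, map_eq_zero_iff _ hc.1, h y]
    refine ⟨?_, ?_⟩
    · rintro ⟨x, rfl⟩
      exact ⟨a x, (e1 x).symm⟩
    · rintro ⟨x, hx⟩
      obtain ⟨x, rfl⟩ := ha.2 x
      exact ⟨x, hb.1 ((e1 x).trans hx)⟩

/-- Two surjections from `X` with the same kernel have canonically isomorphic targets. -/
theorem exists_iso_of_ker_eq {B : Type*} [Ring B] {X Y Z : ModuleCat.{u} B} {f : X ⟶ Y}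
    {g : X ⟶ Z} (hf : Function.Surjective f) (hg : Function.Surjective g)
    (h : ∀ x, f x = 0 ↔ g x = 0) : ∃ α : Y ≅ Z, f ≫ α.hom = g := by
  have hk : LinearMap.ker f.hom = LinearMap.ker g.hom := Submodule.ext h
  refine ⟨((f.hom.quotKerEquivOfSurjective hf).symm ≪≫ₗ Submodule.quotEquivOfEq _ _ hk ≪≫ₗ
    g.hom.quotKerEquivOfSurjective hg).toModuleIso, ?_⟩
  ext x
  have : (f.hom.quotKerEquivOfSurjective hf).symm (f x) = (LinearMap.ker f.hom).mkQ x := by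
    rw [LinearEquiv.symm_apply_eq]
    rfl
  change g.hom.quotKerEquivOfSurjective hg (Submodule.quotEquivOfEq _ _ hk
    ((f.hom.quotKerEquivOfSurjective hf).symm (f x))) = g x
  rw [this]
  rfl

/-- Two injections into `X` with the same image have canonically isomorphic sources. -/
theorem exists_iso_of_range_eq {B : Type*} [Ring B] {X Y Z : ModuleCat.{u} B} {f : Y ⟶ X}
    {g : Z ⟶ X} (hf : Function.Injective f) (hg : Function.Injective g)
    (h : ∀ x, (∃ y, f y = x) ↔ ∃ z, g z = x) : ∃ α : Y ≅ Z, α.hom ≫ g = f := by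
  have hr : LinearMap.range f.hom = LinearMap.range g.hom := Submodule.ext h
  refine ⟨(LinearEquiv.ofInjective f.hom hf ≪≫ₗ LinearEquiv.ofEq _ _ hr ≪≫ₗ
    (LinearEquiv.ofInjective g.hom hg).symm).toModuleIso, ?_⟩
  ext x
  change g.hom ((LinearEquiv.ofInjective g.hom hg).symm _) = _
  rw [← LinearEquiv.ofInjective_apply (h := hg), LinearEquiv.apply_symm_apply]
  rfl

theorem exact_cokernel {B : Type u} [Ring B] {X Y : ModuleCat.{u} B} (f : X ⟶ Y) :
    Function.Exact f (cokernel.π f) :=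
  (ShortComplex.ShortExact.moduleCat_exact_iff_function_exact
    (ShortComplex.mk _ _ (cokernel.condition f))).mp (ShortComplex.exact_cokernel f)

theorem cokernel_π_surjective {B : Type u} [Ring B] {X Y : ModuleCat.{u} B} (f : X ⟶ Y) :
    Function.Surjective (cokernel.π f) :=
  (ModuleCat.epi_iff_surjective _).mp inferInstance

theorem exists_iso_cokernel {B : Type u} [Ring B] {X Y Z : ModuleCat.{u} B} {f : X ⟶ Y}
    {g : Y ⟶ Z} (hfg : Function.Exact f g) (hg : Function.Surjective g) :
    ∃ α : cokernel f ≅ Z, cokernel.π f ≫ α.hom = g := by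
  refine exists_iso_of_ker_eq (cokernel_π_surjective f) hg fun y => ?_
  rw [hfg y]
  exact exact_cokernel f y

theorem exact_kernel {B : Type u} [Ring B] {X Y : ModuleCat.{u} B} (f : X ⟶ Y) :
    Function.Exact (kernel.ι f) f :=
  (ShortComplex.ShortExact.moduleCat_exact_iff_function_exact
    (ShortComplex.mk _ _ (kernel.condition f))).mp (ShortComplex.exact_kernel f)

theorem kernel_ι_injective {B : Type u} [Ring B] {X Y : ModuleCat.{u} B} (f : X ⟶ Y) :
    Function.Injective (kernel.ι f) :=
  (ModuleCat.mono_iff_injective _).mp inferInstance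

end Exactness

/-! ### The spliced complex of a module -/

section Factorization

variable {A : Type u} [Ring A]

/-- If the differential from degree `0` to degree `-1` is a composition `S_0 ⟶ M ⟶ N ⟶ S_{-1}`
with `M` the cokernel of `S_1 ⟶ S_0` and `N ⟶ S_{-1}` injective, then `H_0` is the kernel of
`M ⟶ N`. -/
theorem exists_homology_zero_iso_kernel {S : ChainComplex (ModuleCat.{u} A) ℤ}
    {M N : ModuleCat.{u} A} {e : S.X 0 ⟶ M} {φ : M ⟶ N} {ι : N ⟶ S.X (-1)}
    (he : Function.Surjective e) (h10 : Function.Exact (S.d 1 0) e) (hιi : Function.Injective ι)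
    (hd : ∀ x, S.d 0 (-1) x = ι (φ (e x))) :
    ∃ α : S.homology 0 ≅ kernel φ,
      S.homologyπ 0 ≫ α.hom ≫ kernel.ι φ = S.iCycles 0 ≫ e := by
  -- the cycles in degree `0` are the `x` with `φ (e x) = 0`
  have hcyc : ∀ x : S.X 0, S.d 0 (-1) x = 0 ↔ φ (e x) = 0 := fun x => by
    rw [hd]
    exact map_eq_zero_iff ι.hom hιi
  have hi : Function.Exact (S.iCycles 0) (S.d 0 (-1)) :=
    (ShortComplex.ShortExact.moduleCat_exact_iff_function_exact
      (ShortComplex.mk _ _ (S.iCycles_d 0 (-1)))).mp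
      (ShortComplex.exact_of_f_is_kernel _ (S.cyclesIsKernel 0 (-1) (by simp)))
  have hinj : Function.Injective (S.iCycles 0) := (ModuleCat.mono_iff_injective _).mp inferInstance
  have hπ : Function.Exact (S.toCycles 1 0) (S.homologyπ 0) :=
    (ShortComplex.ShortExact.moduleCat_exact_iff_function_exact
      (ShortComplex.mk _ _ (S.toCycles_comp_homologyπ 1 0))).mp
      (ShortComplex.exact_of_g_is_cokernel _ (S.homologyIsCokernel 1 0 (by simp)))
  have hto : ∀ x, S.iCycles 0 (S.toCycles 1 0 x) = S.d 1 0 x := fun x =>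
    ConcreteCategory.congr_hom (S.toCycles_i 1 0) x
  have hcond : (S.iCycles 0 ≫ e) ≫ φ = 0 := by
    ext x
    exact (hcyc _).mp (hi.apply_apply_eq_zero x)
  let t : S.cycles 0 ⟶ kernel φ := kernel.lift _ _ hcond
  have ht : ∀ x, kernel.ι φ (t x) = e (S.iCycles 0 x) := fun x =>
    ConcreteCategory.congr_hom (kernel.lift_ι _ _ hcond) x
  obtain ⟨α, hα⟩ := exists_iso_of_ker_eq (f := S.homologyπ 0) (g := t)
    ((ModuleCat.epi_iff_surjective _).mp inferInstance)
    (fun z => by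
      obtain ⟨p, hp⟩ := he (kernel.ι φ z)
      obtain ⟨x, rfl⟩ := (hi p).mp ((hcyc p).mpr
        (hp ▸ (exact_kernel φ).apply_apply_eq_zero z))
      exact ⟨x, kernel_ι_injective _ ((ht x).trans hp)⟩)
    (fun x => by
      rw [← map_eq_zero_iff (kernel.ι φ).hom (kernel_ι_injective _), hπ x]
      change _ ↔ kernel.ι φ (t x) = 0
      rw [ht]
      refine Iff.trans ?_ (h10 _).symm
      refine ⟨?_, ?_⟩
      · rintro ⟨y, rfl⟩
        exact ⟨y, (hto y).symm⟩
      · rintro ⟨y, hy⟩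
        exact ⟨y, hinj ((hto y).trans hy)⟩)
  exact ⟨α, by rw [← Category.assoc, hα, kernel.lift_ι]⟩

/-- If the differential from degree `0` to degree `-1` is a composition `S_0 ⟶ M ⟶ N ⟶ S_{-1}`
with `S_0 ⟶ M` surjective and `N` the kernel of `S_{-1} ⟶ S_{-2}`, then `H_{-1}` is the cokernel
of `M ⟶ N`. -/
theorem exists_cokernel_iso_homology_neg_one {S : ChainComplex (ModuleCat.{u} A) ℤ}
    {M N : ModuleCat.{u} A} {e : S.X 0 ⟶ M} {φ : M ⟶ N} {ι : N ⟶ S.X (-1)}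
    (he : Function.Surjective e) (hιi : Function.Injective ι)
    (hιe : Function.Exact ι (S.d (-1) (-2))) (hd : ∀ x, S.d 0 (-1) x = ι (φ (e x))) :
    ∃ α : cokernel φ ≅ S.homology (-1),
      cokernel.π φ ≫ α.hom ≫ S.homologyι (-1) = ι ≫ S.pOpcycles (-1) := by
  let w : N ⟶ S.opcycles (-1) := ι ≫ S.pOpcycles (-1)
  have hp : Function.Exact (S.d 0 (-1)) (S.pOpcycles (-1)) :=
    (ShortComplex.ShortExact.moduleCat_exact_iff_function_exact
      (ShortComplex.mk _ _ (S.d_pOpcycles 0 (-1)))).mp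
      (ShortComplex.exact_of_g_is_cokernel _ (S.opcyclesIsCokernel 0 (-1) (by simp)))
  have hps : Function.Surjective (S.pOpcycles (-1)) :=
    (ModuleCat.epi_iff_surjective _).mp inferInstance
  have hκ : Function.Exact (S.homologyι (-1)) (S.fromOpcycles (-1) (-2)) :=
    (ShortComplex.ShortExact.moduleCat_exact_iff_function_exact
      (ShortComplex.mk _ _ (S.homologyι_comp_fromOpcycles (-1) (-2)))).mp
      (ShortComplex.exact_of_f_is_kernel _ (S.homologyIsKernel (-1) (-2) (by simp)))
  have hfrom : ∀ x, S.fromOpcycles (-1) (-2) (S.pOpcycles (-1) x) =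
      S.d (-1) (-2) x := fun x =>
    ConcreteCategory.congr_hom (S.p_fromOpcycles (-1) (-2)) x
  have hw : ∀ h, w h = 0 ↔ ∃ m, φ m = h := fun h => by
    change S.pOpcycles (-1) (ι h) = 0 ↔ _
    rw [hp]
    refine ⟨?_, ?_⟩
    · rintro ⟨x, hx⟩
      exact ⟨e x, hιi ((hd x).symm.trans hx)⟩
    · rintro ⟨m, rfl⟩
      obtain ⟨x, rfl⟩ := he m
      exact ⟨x, hd x⟩
  have hcond : φ ≫ w = 0 := by
    ext m
    exact (hw _).mpr ⟨m, rfl⟩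
  have hdesc : ∀ h, cokernel.desc _ w hcond (cokernel.π φ h) = w h := fun h =>
    ConcreteCategory.congr_hom (cokernel.π_desc _ w hcond) h
  obtain ⟨α, hα⟩ := exists_iso_of_range_eq (f := cokernel.desc _ w hcond) (g := S.homologyι (-1))
    ((injective_iff_map_eq_zero (cokernel.desc _ w hcond).hom).mpr fun x hx => by
      obtain ⟨h, rfl⟩ := cokernel_π_surjective _ x
      exact (exact_cokernel _ h).mpr ((hw h).mp ((hdesc h).symm.trans hx)))
    ((ModuleCat.mono_iff_injective _).mp inferInstance)
    (fun x => by
      obtain ⟨y, rfl⟩ := hps x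
      refine Iff.trans ?_ (hκ _)
      rw [hfrom]
      refine Iff.trans ?_ (hιe y).symm
      refine ⟨?_, ?_⟩
      · rintro ⟨z, hz⟩
        obtain ⟨h, rfl⟩ := cokernel_π_surjective _ z
        -- `y` differs from `ι h` by a boundary, which is in the image of `ι`
        have hz' : S.pOpcycles (-1) (ι h - y) = 0 := by
          rw [map_sub, sub_eq_zero]
          exact (hdesc h).symm.trans hz
        obtain ⟨x, hx⟩ := (hp _).mp hz'
        refine ⟨h - φ (e x), ?_⟩
        rw [map_sub]
        refine (sub_eq_iff_eq_add.mpr (sub_eq_iff_eq_add'.mp ?_))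
        exact hx.symm.trans (hd x)
      · rintro ⟨h, rfl⟩
        exact ⟨_, hdesc h⟩)
  exact ⟨α, by rw [hα, cokernel.π_desc]⟩

end Factorization

section SpliceComplex

variable {A : Type u} [Ring A] {M : ModuleCat.{u} A} (P : ProjectiveResolution M)
  (Q : ProjectiveResolution (dual M))

theorem splice_d (i : ℤ) : (splice P Q).d (i + 1) i = spliceD P Q i :=
  ChainComplex.of_d _ _ i

theorem splice_d_one : (splice P Q).d 1 0 = P.complex.d 1 0 := splice_d P Q 0

theorem splice_d_zero : (splice P Q).d 0 (-1) =
    augmentation P ≫ phi M ≫ dualRightMap (augmentation Q) :=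
  splice_d P Q (Int.negSucc 0)

theorem splice_d_neg_one : (splice P Q).d (-1) (-2) = dualRightMap (Q.complex.d 1 0) :=
  splice_d P Q (Int.negSucc 1)

theorem isZero_homology_splice (hM : IsSemiGorensteinProjectiveRight (dual M)) (i : ℤ)
    (h0 : i ≠ 0) (h1 : i ≠ -1) : IsZero ((splice P Q).homology i) := by
  obtain ⟨j, rfl⟩ : ∃ j, i = j + 1 := ⟨i - 1, by omega⟩
  rw [isZero_homology_iff, splice_d, splice_d]
  match j with
  | Int.ofNat n => exact exact_d_succ P n
  | Int.negSucc 0 => exact absurd rfl h0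
  | Int.negSucc 1 => exact absurd rfl h1
  | Int.negSucc (n + 2) => exact (isSemiGorensteinProjectiveRight_iff Q).mp hM n

variable [IsArtinianRing Aᵐᵒᵖ]

/-- Identify `Q_n**` with `Q_n` by the canonical maps. In non-negative degrees the dual of the
spliced complex is then `P_•*`, in negative degrees it is `Q_•`, and the map between them is the
composition `Q_0 ⟶ M* ⟶ P_0*`, where `M*` is the kernel of `P_0* ⟶ P_1*`. -/
theorem acyclic_dualComplex_splice (hQ : IsMinimalResolution Q)
    (hM : IsSemiGorensteinProjective M) : (dualComplex (splice P Q)).Acyclic := by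
  have hfin := ((isMinimalResolution_iff Q).mp hQ).1
  have hproj : ∀ n, Module.Projective Aᵐᵒᵖ (Q.complex.X n) := fun n =>
    (IsProjective.iff_projective (Q.complex.X n)).mpr (Q.projective n)
  have hphi : ∀ n, Function.Bijective (phiRight (Q.complex.X n)) := fun n => phiRight_bijective _
  have hid : ∀ X : ModuleCat.{u} Aᵐᵒᵖ, Function.Bijective (𝟙 X : X ⟶ X) := fun X =>
    Function.bijective_id
  have hker := exact_dualMap_of_exact (exact_d_augmentation P) (augmentation_surjective P)
  have hmono := dualMap_injective (augmentation_surjective P)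
  rw [acyclic_dualComplex_iff]
  intro j
  rw [splice_d, splice_d]
  match j with
  | Int.ofNat n => exact (isSemiGorensteinProjective_iff P).mp hM n
  | Int.negSucc 0 =>
    refine (exact_iff_of_bijective (f := augmentation Q ≫ dualMap (augmentation P))
      (g := dualMap (P.complex.d 1 0)) (hphi 0) (hid _) (hid _) rfl rfl).mpr fun g => ?_
    rw [hker g]
    -- both sides say that `g` is in the image of `M*`
    refine ⟨?_, ?_⟩
    · rintro ⟨g, rfl⟩
      obtain ⟨y, rfl⟩ := augmentation_surjective Q g
      exact ⟨y, rfl⟩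
    · rintro ⟨y, rfl⟩
      exact ⟨augmentation Q y, rfl⟩
  | Int.negSucc 1 =>
    refine (exact_iff_of_bijective (f := Q.complex.d 1 0)
      (g := augmentation Q ≫ dualMap (augmentation P)) (hphi 1) (hphi 0) (hid _)
      rfl rfl).mpr fun y => ?_
    rw [← exact_d_augmentation Q y]
    exact map_eq_zero_iff (dualMap (augmentation P)).hom hmono
  | Int.negSucc (n + 2) =>
    exact (exact_iff_of_bijective (f := Q.complex.d (n + 2) (n + 1)) (g := Q.complex.d (n + 1) n)
      (hphi _) (hphi _) (hphi _) rfl rfl).mpr (exact_d_succ Q n)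

/-- In degree `0` minimality comes from `M` being reduced, in the other degrees from the minimality
of the two resolutions. -/
theorem isMinimalComplex_splice [IsArtinianRing A] (hP : IsMinimalResolution P)
    (hQ : IsMinimalResolution Q) (hM : IsReducedModule M) : IsMinimalComplex (splice P Q) := by
  obtain ⟨-, hPr⟩ := (isMinimalResolution_iff P).mp hP
  obtain ⟨hQf, hQr⟩ := (isMinimalResolution_iff Q).mp hQ
  have hproj : ∀ n, Module.Projective Aᵐᵒᵖ (Q.complex.X n) := fun n =>
    (IsProjective.iff_projective (Q.complex.X n)).mpr (Q.projective n)
  intro i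
  obtain ⟨j, rfl⟩ : ∃ j, i = j + 1 := ⟨i - 1, by omega⟩
  rw [add_sub_cancel_right, splice_d]
  match j with
  | Int.ofNat n => exact hPr n
  | Int.negSucc 0 =>
    refine le_trans ?_ (range_le_jacobson_of_isReducedModule hM
      (P := dualRight (Q.complex.X 0)) (phi M ≫ dualRightMap (augmentation Q)).hom)
    rintro _ ⟨x, rfl⟩
    exact ⟨augmentation P x, rfl⟩
  | Int.negSucc (n + 1) => exact range_dualRightMap_le_jacobson _ (hQr n)

theorem goodComplex_splice [IsArtinianRing A] (hP : IsMinimalResolution P)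
    (hQ : IsMinimalResolution Q) (hM : goodModule A M) : goodComplex A (splice P Q) := by
  obtain ⟨hPf, -⟩ := (isMinimalResolution_iff P).mp hP
  obtain ⟨hQf, -⟩ := (isMinimalResolution_iff Q).mp hQ
  have hproj : ∀ n, Module.Projective Aᵐᵒᵖ (Q.complex.X n) := fun n =>
    (IsProjective.iff_projective (Q.complex.X n)).mpr (Q.projective n)
  refine ⟨fun i => ?_, isMinimalComplex_splice P Q hP hQ hM.2.1,
    isZero_homology_splice P Q hM.2.2.2, acyclic_dualComplex_splice P Q hQ hM.2.2.1⟩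
  rw [isFiniteLength_iff_finite]
  match i with
  | Int.ofNat n => exact ⟨hPf n, (IsProjective.iff_projective _).mpr (P.projective n)⟩
  | Int.negSucc n => exact ⟨finite_dualRight_of_projective (Q.complex.X n),
      projective_dualRight (Q.complex.X n)⟩

omit [IsArtinianRing Aᵐᵒᵖ] in
theorem exists_cokernel_splice_iso :
    ∃ α : cokernel ((splice P Q).d 1 0) ≅ M,
      cokernel.π ((splice P Q).d 1 0) ≫ α.hom = augmentation P :=
  exists_iso_cokernel (splice_d_one P Q ▸ exact_d_augmentation P) (augmentation_surjective P)

theorem exists_dual_iso_cokernel (hQ : IsMinimalResolution Q) :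
    ∃ α : dual M ≅ cokernel ((dualComplex (splice P Q)).d (-2) (-1)),
      augmentation Q ≫ α.hom = phiRight (Q.complex.X 0) ≫
        cokernel.π ((dualComplex (splice P Q)).d (-2) (-1)) := by
  have hfin := ((isMinimalResolution_iff Q).mp hQ).1
  have hproj : ∀ n, Module.Projective Aᵐᵒᵖ (Q.complex.X n) := fun n =>
    (IsProjective.iff_projective (Q.complex.X n)).mpr (Q.projective n)
  have hphi : ∀ n, Function.Bijective (phiRight (Q.complex.X n)) := fun n => phiRight_bijective _
  have hd : (dualComplex (splice P Q)).d (-2) (-1) = dualMap (dualRightMap (Q.complex.d 1 0)) :=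
    congrArg dualMap (splice_d_neg_one P Q)
  refine exists_iso_of_ker_eq (augmentation_surjective Q)
    ((cokernel_π_surjective _).comp (hphi 0).2) fun y => ?_
  rw [exact_d_augmentation Q y]
  refine Iff.trans ?_ (exact_cokernel ((dualComplex (splice P Q)).d (-2) (-1))
    (phiRight (Q.complex.X 0) y)).symm
  rw [hd]
  refine ⟨?_, ?_⟩
  · rintro ⟨x, rfl⟩
    exact ⟨phiRight _ x, rfl⟩
  · rintro ⟨z, hz⟩
    obtain ⟨x, rfl⟩ := (hphi 1).2 z
    exact ⟨x, (hphi 0).1 hz⟩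

omit [IsArtinianRing Aᵐᵒᵖ] in
theorem splice_d_zero_apply (x : P.complex.X 0) : (splice P Q).d 0 (-1) x =
    dualRightMap (augmentation Q) (phi M (augmentation P x)) :=
  ConcreteCategory.congr_hom (splice_d_zero P Q) x

omit [IsArtinianRing Aᵐᵒᵖ] in
theorem exists_homology_splice_zero_iso :
    ∃ α : (splice P Q).homology 0 ≅ kernel (phi M),
      (splice P Q).homologyπ 0 ≫ α.hom ≫ kernel.ι (phi M) =
        (splice P Q).iCycles 0 ≫ augmentation P :=
  exists_homology_zero_iso_kernel (S := splice P Q) (augmentation_surjective P)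
    (splice_d_one P Q ▸ exact_d_augmentation P)
    (dualRightMap_injective (augmentation_surjective Q)) (splice_d_zero_apply P Q)

omit [IsArtinianRing Aᵐᵒᵖ] in
theorem exists_homology_splice_neg_one_iso :
    ∃ α : cokernel (phi M) ≅ (splice P Q).homology (-1),
      cokernel.π (phi M) ≫ α.hom ≫ (splice P Q).homologyι (-1) =
        dualRightMap (augmentation Q) ≫ (splice P Q).pOpcycles (-1) :=
  exists_cokernel_iso_homology_neg_one (S := splice P Q) (augmentation_surjective P)
    (dualRightMap_injective (augmentation_surjective Q))
    (splice_d_neg_one P Q ▸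
      exact_dualRightMap_of_exact (exact_d_augmentation Q) (augmentation_surjective Q))
    (splice_d_zero_apply P Q)

end SpliceComplex

/-! ### Isomorphisms of spliced complexes -/

section SpliceIso

variable {A : Type u} [Ring A]

theorem nonempty_iso_of_components {S T : ChainComplex (ModuleCat.{u} A) ℤ}
    (f : ∀ i, S.X i ⟶ T.X i) (hf : ∀ i, Function.Bijective (f i))
    (h : ∀ i, f (i + 1) ≫ T.d (i + 1) i = S.d (i + 1) i ≫ f i) : Nonempty (S ≅ T) := by
  have : ∀ i, IsIso (f i) := fun i => (ConcreteCategory.isIso_iff_bijective _).mpr (hf i)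
  refine ⟨HomologicalComplex.Hom.isoOfComponents (fun i => asIso (f i)) fun i j hij => ?_⟩
  obtain rfl : j + 1 = i := hij
  exact h j

theorem dualMap_bijective {X Y : ModuleCat.{u} A} (f : X ⟶ Y) [IsIso f] :
    Function.Bijective (dualMap f) := by
  refine Function.bijective_iff_has_inverse.mpr ⟨dualMap (inv f), fun g => ?_, fun g => ?_⟩
  · change dualMap (inv f ≫ f) g = g
    rw [IsIso.inv_hom_id]
    rfl
  · change dualMap (f ≫ inv f) g = g
    rw [IsIso.hom_inv_id]
    rfl

theorem dualRightMap_bijective {X Y : ModuleCat.{u} Aᵐᵒᵖ} (f : X ⟶ Y) [IsIso f] :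
    Function.Bijective (dualRightMap f) := by
  refine Function.bijective_iff_has_inverse.mpr ⟨dualRightMap (inv f), fun g => ?_, fun g => ?_⟩
  · change dualRightMap (inv f ≫ f) g = g
    rw [IsIso.inv_hom_id]
    rfl
  · change dualRightMap (f ≫ inv f) g = g
    rw [IsIso.hom_inv_id]
    rfl

/-- The map `P_• ⟶ P'_•` in non-negative degrees and the dual of the map `Q'_• ⟶ Q_•` in negative
degrees, for lifts of an isomorphism `M ⟶ M'` and of its dual. -/
def spliceMapX {M M' : ModuleCat.{u} A} {P : ProjectiveResolution M}
    {Q : ProjectiveResolution (dual M)} {P' : ProjectiveResolution M'}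
    {Q' : ProjectiveResolution (dual M')} (a : P.complex ⟶ P'.complex)
    (b : Q'.complex ⟶ Q.complex) : ∀ i, (splice P Q).X i ⟶ (splice P' Q').X i
  | Int.ofNat n => a.f n
  | Int.negSucc n => dualRightMap (b.f n)

theorem nonempty_splice_iso [IsArtinianRing A] [IsArtinianRing Aᵐᵒᵖ] {M M' : ModuleCat.{u} A}
    (e : M ≅ M') {P : ProjectiveResolution M}
    {Q : ProjectiveResolution (dual M)} {P' : ProjectiveResolution M'}
    {Q' : ProjectiveResolution (dual M')} (hP : IsMinimalResolution P) (hQ : IsMinimalResolution Q)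
    (hP' : IsMinimalResolution P') (hQ' : IsMinimalResolution Q') :
    Nonempty (splice P Q ≅ splice P' Q') := by
  have he : IsIso (dualMap e.hom) :=
    (ConcreteCategory.isIso_iff_bijective _).mpr (dualMap_bijective e.hom)
  let a := ProjectiveResolution.lift e.hom P P'
  let b := ProjectiveResolution.lift (dualMap e.hom) Q' Q
  have ha : ∀ n, IsIso (a.f n) := isIso_lift e hP hP'
  have hb : ∀ n, IsIso (b.f n) := isIso_lift (asIso (dualMap e.hom)) hQ' hQ
  have ha0 : a.f 0 ≫ augmentation P' = augmentation P ≫ e.hom := lift_augmentation e.hom P P'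
  have hb0 : b.f 0 ≫ augmentation Q = augmentation Q' ≫ dualMap e.hom :=
    lift_augmentation (dualMap e.hom) Q' Q
  refine nonempty_iso_of_components (spliceMapX a b) (fun i => ?_) (fun i => ?_)
  · match i with
    | Int.ofNat n => exact (ConcreteCategory.isIso_iff_bijective _).mp (ha n)
    | Int.negSucc n => exact dualRightMap_bijective (b.f n)
  · rw [splice_d, splice_d]
    match i with
    | Int.ofNat n => exact a.comm (n + 1) n
    | Int.negSucc 0 =>
      change a.f 0 ≫ augmentation P' ≫ phi M' ≫ dualRightMap (augmentation Q') =
        augmentation P ≫ phi M ≫ dualRightMap (b.f 0 ≫ augmentation Q)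
      rw [hb0, reassoc_of% ha0]
      rfl
    | Int.negSucc (n + 1) => exact congrArg dualRightMap (b.comm (n + 1) n).symm

end SpliceIso

/-! ### The module of a complex -/

section ComplexToModule

variable {A : Type u} [Ring A]

/-- The part of a complex in non-negative degrees. -/
def nonnegPart (P : ChainComplex (ModuleCat.{u} A) ℤ) : ChainComplex (ModuleCat.{u} A) ℕ where
  X n := P.X (Int.ofNat n)
  d i j := P.d (Int.ofNat i) (Int.ofNat j)
  shape _ _ h := P.shape _ _ fun hij => h (Int.ofNat.inj hij)
  d_comp_d' _ _ _ _ _ := P.d_comp_d _ _ _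

/-- The dual of the part of a complex in negative degrees, with `P_{-n-1}*` in degree `n`. -/
def dualNegPart (P : ChainComplex (ModuleCat.{u} A) ℤ) : ChainComplex (ModuleCat.{u} Aᵐᵒᵖ) ℕ where
  X n := dual (P.X (Int.negSucc n))
  d i j := dualMap (P.d (Int.negSucc j) (Int.negSucc i))
  shape _ _ h := by
    rw [P.shape _ _ fun hij => h ?_, dualMap_zero]
    rw [ComplexShape.down_Rel] at hij ⊢
    omega
  d_comp_d' _ _ _ _ _ := by rw [← dualMap_comp, P.d_comp_d, dualMap_zero]

variable {P : ChainComplex (ModuleCat.{u} A) ℤ} (hP : goodComplex A P)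

include hP

theorem goodComplex.projective (i : ℤ) : Module.Projective A (P.X i) := (hP.1 i).2

theorem goodComplex.range_d_le (i : ℤ) :
    LinearMap.range (P.d (i + 1) i).hom ≤ Module.jacobson A (P.X i) := by
  have h := hP.2.1 (i + 1)
  rwa [add_sub_cancel_right] at h

theorem goodComplex.exact_d (j : ℤ) (h0 : j + 1 ≠ 0) (h1 : j + 1 ≠ -1) :
    Function.Exact (P.d (j + 1 + 1) (j + 1)) (P.d (j + 1) j) :=
  (isZero_homology_iff P j).mp (hP.2.2.1 _ h0 h1)

theorem goodComplex.exact_dualMap_d (j : ℤ) :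
    Function.Exact (dualMap (P.d (j + 1) j)) (dualMap (P.d (j + 1 + 1) (j + 1))) :=
  (acyclic_dualComplex_iff P).mp hP.2.2.2 j

theorem goodComplex.finite [IsArtinianRing A] (i : ℤ) : Module.Finite A (P.X i) :=
  isFiniteLength_iff_finite.mp (hP.1 i).1

theorem goodComplex.projective_dual [IsArtinianRing A] (i : ℤ) :
    Module.Projective Aᵐᵒᵖ (dual (P.X i)) := by
  have hfin := hP.finite i
  have hproj := hP.projective i
  infer_instance

theorem goodComplex.finite_dual [IsArtinianRing A] (i : ℤ) :
    Module.Finite Aᵐᵒᵖ (dual (P.X i)) := by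
  have hfin := hP.finite i
  have hproj := hP.projective i
  infer_instance

variable {M : ModuleCat.{u} A} {e : P.X 0 ⟶ M} {m : M ⟶ P.X (-1)}
  (he : Function.Surjective e) (h10 : Function.Exact (P.d 1 0) e) (hem : e ≫ m = P.d 0 (-1))

/-- The non-negative part of `P_•` as a projective resolution of `M = Cok f_1`. -/
def goodComplex.resolution : ProjectiveResolution M :=
  resolutionOfExact (nonnegPart P) (fun _ => hP.projective _) e he h10
    fun n => hP.exact_d (Int.ofNat n) (by simp; omega) (by simp; omega)

theorem goodComplex.isMinimalResolution_resolution [IsArtinianRing A] :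
    IsMinimalResolution (hP.resolution he h10) :=
  (isMinimalResolution_iff _).mpr
    ⟨fun _ => hP.finite _, fun n => hP.range_d_le (Int.ofNat n)⟩

include h10 in
/-- Exactness of `P_{-2}* ⟶ P_{-1}* ⟶ M* ⟶ 0`: as `M = Cok f_1`, the module `M*` is the kernel of
`P_0* ⟶ P_1*`, and `P_•*` is exact in degrees `0` and `-1`. -/
theorem goodComplex.exact_dualMap_neg_one (he : Function.Surjective e)
    (hem : e ≫ m = P.d 0 (-1)) :
    Function.Exact (dualMap (P.d (-1) (-2))) (dualMap m) ∧ Function.Surjective (dualMap m) := by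
  have h2 := hP.exact_dualMap_d (Int.negSucc 0)
  have h1 := hP.exact_dualMap_d (Int.negSucc 1)
  have hm : ∀ g, dualMap e (dualMap m g) = dualMap (P.d 0 (-1)) g := fun g =>
    ConcreteCategory.congr_hom (congrArg dualMap hem) g
  refine ⟨fun g => ?_, fun g => ?_⟩
  · rw [← map_eq_zero_iff (dualMap e).hom (dualMap_injective he)]
    exact (congrArg (· = 0) (hm g)).to_iff.trans (h1 g)
  · obtain ⟨k, hk⟩ := (h2 (dualMap e g)).mp
      ((exact_dualMap_of_exact h10 he).apply_apply_eq_zero g)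
    exact ⟨k, dualMap_injective he ((hm k).trans hk)⟩

variable [IsArtinianRing A]

/-- The dual of the negative part of `P_•` as a projective resolution of `M*`. The augmentation is
the dual of the map `M ⟶ P_{-1}` through which `f_0` factors. -/
def goodComplex.dualResolution : ProjectiveResolution (dual M) :=
  resolutionOfExact (dualNegPart P) (fun n => hP.projective_dual (Int.negSucc n)) (dualMap m)
    (hP.exact_dualMap_neg_one h10 he hem).2 (hP.exact_dualMap_neg_one h10 he hem).1
    fun n => hP.exact_dualMap_d (Int.negSucc (n + 2))

theorem goodComplex.isMinimalResolution_dualResolution [IsArtinianRing Aᵐᵒᵖ] :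
    IsMinimalResolution (hP.dualResolution he h10 hem) :=
  (isMinimalResolution_iff _).mpr
    ⟨fun n => hP.finite_dual (Int.negSucc n), fun n =>
      have := hP.finite (Int.negSucc n)
      have := hP.projective (Int.negSucc n)
      range_dualMap_le_jacobson (P.d (Int.negSucc n) (Int.negSucc (n + 1)))
        (hP.range_d_le (Int.negSucc (n + 1)))⟩

/-- `M = Cok f_1` is reduced. For a projective direct summand `U` of `M`, the composition
`P_0 ⟶ M ⟶ U` factors through `f_0`, since `P_•*` is exact in degree `0`; so by minimality its
image, which is `U`, is contained in the radical of `U`. -/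
theorem goodComplex.isReducedModule (he : Function.Surjective e)
    (h10 : Function.Exact (P.d 1 0) e) : IsReducedModule M := by
  intro U V hUV hU
  have h2 := hP.exact_dualMap_d (Int.negSucc 0)
  have hfin := hP.finite 0
  let p : P.X 0 →ₗ[A] U := Submodule.projectionOnto U V hUV ∘ₗ e.hom
  have hp : Function.Surjective p :=
    (Submodule.projectionOnto_surjective hUV).comp he
  have : Module.Finite A U := Module.Finite.of_surjective p hp
  obtain ⟨n, a, f, hf⟩ := isRegularBimodule_self.exists_dualBasis (C := Aᵐᵒᵖ) (M := U)
  have hk : ∀ i, ∃ k : P.X (-1) →ₗ[A] A, k ∘ₗ (P.d 0 (-1)).hom = f i ∘ₗ p := fun i =>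
    (h2 (f i ∘ₗ p)).mp (LinearMap.ext fun x => by
      have hx : e (P.d 1 0 x) = 0 := h10.apply_apply_eq_zero x
      change f i (Submodule.projectionOnto U V hUV (e (P.d 1 0 x))) = 0
      rw [hx, map_zero, map_zero])
  choose k hk using hk
  have htop : Module.jacobson A U = ⊤ := by
    refine eq_top_iff.mpr fun u _ => ?_
    obtain ⟨x, rfl⟩ := hp u
    rw [← hf (p x)]
    refine sum_mem fun i _ => ?_
    have hx : f i (p x) = k i (P.d 0 (-1) x) := (LinearMap.congr_fun (hk i) x).symm
    rw [hx]
    exact Module.map_jacobson_le (LinearMap.toSpanSingleton A U (a i) ∘ₗ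
      (isRegularBimodule_self (A := A)).coord.toLinearMap ∘ₗ k i)
      ⟨_, hP.range_d_le (-1) ⟨x, rfl⟩, rfl⟩
  by_contra hne
  have : Nontrivial U := (Submodule.nontrivial_iff_ne_bot).mpr hne
  exact (Module.jacobson_lt_top A U).ne htop

include he h10 hem in
/-- The non-negative part of `P_•` and the dual of its negative part compute the groups
`Ext^i(M, A)` and `Ext^i(M*, A)`: the former are the cohomology of `P_•*` in positive degrees, the
latter, as `P_i** = P_i`, the homology of `P_•` in degrees below `-1`. -/
theorem goodComplex.goodModule : goodModule A M := by
  have hfin := hP.finite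
  have hproj := hP.projective
  have hphi : ∀ i, Function.Bijective (phi (P.X i)) := fun i => phi_bijective _
  refine ⟨isFiniteLength_iff_finite.mpr (Module.Finite.of_surjective e.hom he),
    hP.isReducedModule he h10,
    (isSemiGorensteinProjective_iff (hP.resolution he h10)).mpr fun n =>
      hP.exact_dualMap_d (Int.ofNat n),
    (isSemiGorensteinProjectiveRight_iff (hP.dualResolution he h10 hem)).mpr fun n => ?_⟩
  exact (exact_iff_of_bijective (f := P.d (Int.negSucc n) (Int.negSucc (n + 1)))
    (g := P.d (Int.negSucc (n + 1)) (Int.negSucc (n + 2))) (hphi _) (hphi _) (hphi _)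
    rfl rfl).mpr (hP.exact_d (Int.negSucc (n + 2)) (by simp; omega) (by simp; omega))

/-- The comparison of `P_•` with the complex spliced from its non-negative part and the dual of its
negative part: the identity in non-negative degrees and `φ` in negative degrees. -/
def goodComplex.toSpliceX : ∀ i, P.X i ⟶
    (splice (hP.resolution he h10) (hP.dualResolution he h10 hem)).X i
  | Int.ofNat _ => 𝟙 _
  | Int.negSucc n => phi (P.X (Int.negSucc n))

theorem goodComplex.nonempty_iso_splice :
    Nonempty (P ≅ splice (hP.resolution he h10) (hP.dualResolution he h10 hem)) := by
  have hfin := hP.finite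
  have hproj := hP.projective
  have haP : augmentation (hP.resolution he h10) = e := augmentation_resolutionOfExact ..
  have haQ : augmentation (hP.dualResolution he h10 hem) = dualMap m :=
    augmentation_resolutionOfExact (dualNegPart P) (fun n => hP.projective_dual (Int.negSucc n))
      (dualMap m) (hP.exact_dualMap_neg_one h10 he hem).2 (hP.exact_dualMap_neg_one h10 he hem).1
      fun n => hP.exact_dualMap_d (Int.negSucc (n + 2))
  refine nonempty_iso_of_components (hP.toSpliceX he h10 hem) (fun i => ?_) (fun i => ?_)
  · match i with
    | Int.ofNat n => exact Function.bijective_id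
    | Int.negSucc n => exact phi_bijective (P.X (Int.negSucc n))
  · rw [splice_d]
    match i with
    | Int.ofNat n => exact (Category.id_comp _).trans (Category.comp_id _).symm
    | Int.negSucc 0 =>
      change 𝟙 (P.X 0) ≫ augmentation (hP.resolution he h10) ≫ phi M ≫
        dualRightMap (augmentation (hP.dualResolution he h10 hem)) =
          P.d 0 (-1) ≫ phi (P.X (-1))
      rw [haP, haQ, ← hem]
      rfl
    | Int.negSucc (n + 1) => rfl

include he h10 hem in
/-- `M* = Cok f_{-1}*`, and dually `M** = Ker f_{-1}**`, which is `Ker f_{-1}` by the canonical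
isomorphisms `P_i = P_i**`. -/
theorem goodComplex.exists_dual_iso_kernel_iso :
    ∃ (β : cokernel ((dualComplex P).d (-2) (-1)) ≅ dual M)
      (γ : kernel (P.d (-1) (-2)) ≅ dualRight (dual M)),
      cokernel.π ((dualComplex P).d (-2) (-1)) ≫ β.hom ≫ dualMap e = dualMap (P.d 0 (-1)) ∧
      kernel.ι (P.d (-1) (-2)) ≫ phi (P.X (-1)) =
        γ.hom ≫ dualRightMap (cokernel.π ((dualComplex P).d (-2) (-1)) ≫ β.hom) := by
  have hfin := hP.finite
  have hproj := hP.projective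
  have hphi : ∀ i, Function.Bijective (phi (P.X i)) := fun i => phi_bijective _
  obtain ⟨hex, hsurj⟩ := hP.exact_dualMap_neg_one h10 he hem
  obtain ⟨β, hβ⟩ := exists_iso_cokernel (f := (dualComplex P).d (-2) (-1)) hex hsurj
  have hex' := exact_dualRightMap_of_exact hex hsurj
  obtain ⟨γ, hγ⟩ := exists_iso_of_range_eq
    (f := kernel.ι (P.d (-1) (-2)) ≫ phi (P.X (-1))) (g := dualRightMap (dualMap m))
    ((hphi (-1)).1.comp (kernel_ι_injective _)) (dualRightMap_injective hsurj) fun h => by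
      obtain ⟨x, rfl⟩ := (hphi (-1)).2 h
      refine Iff.trans ?_ (hex' _)
      change _ ↔ phi (P.X (-2)) (P.d (-1) (-2) x) = 0
      rw [map_eq_zero_iff (phi (P.X (-2))).hom (hphi (-2)).1]
      refine Iff.trans ?_ (exact_kernel (P.d (-1) (-2)) x).symm
      exact exists_congr fun y => (hphi (-1)).1.eq_iff
  refine ⟨β, γ, ?_, ?_⟩
  · rw [← Category.assoc, hβ, ← hem]
    rfl
  · rw [hβ]
    exact hγ.symm

end ComplexToModule

/-! ### The bijection -/

section Bijection

variable {A : Type u} [Ring A]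

theorem isoClass_eq_iff {C : Type*} [Category C] (p : ObjectProperty C) {X Y : C} (hX : p X)
    (hY : p Y) : isoClass p X hX = isoClass p Y hY ↔ Nonempty (X ≅ Y) := by
  refine Quotient.eq.trans ⟨fun ⟨e⟩ => ⟨p.ι.mapIso e⟩, fun ⟨e⟩ => ⟨p.isoMk e⟩⟩

/-- The factorization of `f_0` through `Cok f_1`. -/
theorem cokernel_π_desc_d {P : ChainComplex (ModuleCat.{u} A) ℤ} :
    cokernel.π (P.d 1 0) ≫ cokernel.desc (P.d 1 0) (P.d 0 (-1)) (P.d_comp_d _ _ _) =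
      P.d 0 (-1) :=
  cokernel.π_desc _ _ _

theorem goodComplex.goodModule_cokernel [IsArtinianRing A]
    {P : ChainComplex (ModuleCat.{u} A) ℤ} (hP : goodComplex A P) :
    SemiGorenstein.goodModule A (cokernel (P.d 1 0)) :=
  hP.goodModule (cokernel_π_surjective _) (exact_cokernel _) cokernel_π_desc_d

/-- The map `P_• ↦ Cok f_1` on isomorphism classes. -/
def cokernelClass [IsArtinianRing A] : IsoClasses (goodComplex A) → IsoClasses (goodModule A) :=
  Quotient.lift (fun P => isoClass (goodModule A) (cokernel (P.obj.d 1 0))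
    (goodComplex.goodModule_cokernel P.property)) fun _ _ ⟨e⟩ =>
      (isoClass_eq_iff _ _ _).mpr ⟨cokernel.mapIso _ _
        ((HomologicalComplex.eval _ _ 1).mapIso ((goodComplex A).ι.mapIso e))
        ((HomologicalComplex.eval _ _ 0).mapIso ((goodComplex A).ι.mapIso e))
        (((goodComplex A).ι.mapIso e).hom.comm 1 0).symm⟩

theorem cokernelClass_splice [IsArtinianRing A] {M : ModuleCat.{u} A} (hM : goodModule A M)
    (P : ProjectiveResolution M) (Q : ProjectiveResolution (dual M))
    (h : goodComplex A (splice P Q)) :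
    cokernelClass (isoClass _ (splice P Q) h) = isoClass _ M hM :=
  (isoClass_eq_iff _ _ _).mpr ⟨(exists_cokernel_splice_iso P Q).choose⟩

theorem goodModule.exists_resolutions [IsArtinianRing A] [IsArtinianRing Aᵐᵒᵖ]
    {M : ModuleCat.{u} A} (hM : goodModule A M) :
    (∃ P : ProjectiveResolution M, IsMinimalResolution P) ∧
      ∃ Q : ProjectiveResolution (dual M), IsMinimalResolution Q := by
  have := isFiniteLength_iff_finite.mp hM.1
  have := finite_dual M
  exact ⟨exists_isMinimalResolution M, exists_isMinimalResolution (dual M)⟩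

/-- Injectivity: an isomorphism of the cokernels induces an isomorphism of the complexes spliced
from the minimal resolutions of the cokernels and of their duals, and the given complexes are
isomorphic to these. -/
theorem cokernelClass_bijective [IsArtinianRing A] [IsArtinianRing Aᵐᵒᵖ] :
    Function.Bijective (cokernelClass (A := A)) := by
  refine ⟨?_, ?_⟩
  · rintro ⟨P, hP⟩ ⟨P', hP'⟩ h
    obtain ⟨e⟩ := (isoClass_eq_iff _ _ _).mp h
    have h1 := cokernel_π_surjective (P.d 1 0)
    have h1' := cokernel_π_surjective (P'.d 1 0)
    have h2 := exact_cokernel (P.d 1 0)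
    have h2' := exact_cokernel (P'.d 1 0)
    have h3 := cokernel_π_desc_d (P := P)
    have h3' := cokernel_π_desc_d (P := P')
    obtain ⟨α⟩ := hP.nonempty_iso_splice h1 h2 h3
    obtain ⟨α'⟩ := hP'.nonempty_iso_splice h1' h2' h3'
    obtain ⟨ε⟩ := nonempty_splice_iso e (hP.isMinimalResolution_resolution h1 h2)
      (hP.isMinimalResolution_dualResolution h1 h2 h3)
      (hP'.isMinimalResolution_resolution h1' h2')
      (hP'.isMinimalResolution_dualResolution h1' h2' h3')
    exact (isoClass_eq_iff _ hP hP').mpr ⟨α ≪≫ ε ≪≫ α'.symm⟩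
  · rintro ⟨M, hM⟩
    obtain ⟨⟨P, hP⟩, ⟨Q, hQ⟩⟩ := hM.exists_resolutions
    exact ⟨isoClass _ (splice P Q) (goodComplex_splice P Q hP hQ hM),
      cokernelClass_splice hM P Q _⟩

end Bijection

end SemiGorenstein

end

open SemiGorenstein in
theorem theorem2p1 {R : Type*} [CommRing R] [IsArtinianRing R]
    {A : Type u} [Ring A] [Algebra R A] [Module.Finite R A] :
    ∃ Φ : IsoClasses (goodModule A) ≃ IsoClasses (goodComplex A),
      -- from modules to complexes
      (∀ (M : ModuleCat.{u} A) (hM : goodModule A M),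
        (∃ P : ProjectiveResolution M, IsMinimalResolution P) ∧
        (∃ Q : ProjectiveResolution (dual M), IsMinimalResolution Q) ∧
        ∀ (P : ProjectiveResolution M) (Q : ProjectiveResolution (dual M)),
          IsMinimalResolution P → IsMinimalResolution Q →
          (∃ h : goodComplex A (splice P Q),
            Φ (isoClass _ M hM) = isoClass _ (splice P Q) h) ∧
          -- `M = Cok f_1`, `M* = Cok d_1` and `M* = Cok f_{-1}*`, by the canonical maps
          (∃ α : cokernel ((splice P Q).d 1 0) ≅ M,
            cokernel.π ((splice P Q).d 1 0) ≫ α.hom = augmentation P) ∧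
          (∃ α : cokernel (Q.complex.d 1 0) ≅ dual M,
            cokernel.π (Q.complex.d 1 0) ≫ α.hom = augmentation Q) ∧
          (∃ α : dual M ≅ cokernel ((dualComplex (splice P Q)).d (-2) (-1)),
            augmentation Q ≫ α.hom =
              phiRight (Q.complex.X 0) ≫
                cokernel.π ((dualComplex (splice P Q)).d (-2) (-1))) ∧
          -- `H_0 = Ker φ_M`, induced by `e : P_0 ⟶ M`
          (∃ α : (splice P Q).homology 0 ≅ kernel (phi M),
            (splice P Q).homologyπ 0 ≫ α.hom ≫ kernel.ι (phi M) =
              (splice P Q).iCycles 0 ≫ augmentation P) ∧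
          -- `H_{-1} = Cok φ_M`, induced by `q* : M** ⟶ P_{-1}`
          (∃ α : cokernel (phi M) ≅ (splice P Q).homology (-1),
            cokernel.π (phi M) ≫ α.hom ≫ (splice P Q).homologyι (-1) =
              dualRightMap (augmentation Q) ≫ (splice P Q).pOpcycles (-1))) ∧
      -- from complexes to modules
      (∀ (P : ChainComplex (ModuleCat.{u} A) ℤ) (hP : goodComplex A P),
        (∃ h : goodModule A (cokernel (P.d 1 0)),
          Φ.symm (isoClass _ P hP) = isoClass _ (cokernel (P.d 1 0)) h) ∧
        -- `M* = Cok f_{-1}*` and `M** = Ker f_{-1}` for `M = Cok f_1`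
        (∃ (β : cokernel ((dualComplex P).d (-2) (-1)) ≅ dual (cokernel (P.d 1 0)))
            (γ : kernel (P.d (-1) (-2)) ≅ dualRight (dual (cokernel (P.d 1 0)))),
          cokernel.π ((dualComplex P).d (-2) (-1)) ≫ β.hom ≫
              dualMap (cokernel.π (P.d 1 0)) = dualMap (P.d 0 (-1)) ∧
          kernel.ι (P.d (-1) (-2)) ≫ phi (P.X (-1)) =
            γ.hom ≫ dualRightMap (cokernel.π ((dualComplex P).d (-2) (-1)) ≫ β.hom))) := by
  have hA : IsArtinianRing A := IsArtinianRing.of_finite R A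
  have : Module.Finite R Aᵐᵒᵖ := Module.Finite.equiv (MulOpposite.opLinearEquiv R)
  have hAop : IsArtinianRing Aᵐᵒᵖ := IsArtinianRing.of_finite R Aᵐᵒᵖ
  refine ⟨(Equiv.ofBijective cokernelClass cokernelClass_bijective).symm,
    fun M hM => ⟨hM.exists_resolutions.1, hM.exists_resolutions.2, fun P Q hP hQ => ?_⟩,
    fun P hP => ⟨⟨hP.goodModule_cokernel, rfl⟩, hP.exists_dual_iso_kernel_iso
      (cokernel_π_surjective _) (exact_cokernel _) cokernel_π_desc_d⟩⟩
  have h := goodComplex_splice P Q hP hQ hM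
  exact ⟨⟨h, (Equiv.symm_apply_eq _).mpr (cokernelClass_splice hM P Q h).symm⟩,
    exists_cokernel_splice_iso P Q,
    exists_iso_cokernel (exact_d_augmentation Q) (augmentation_surjective Q),
    exists_dual_iso_cokernel P Q hQ, exists_homology_splice_zero_iso P Q,
    exists_homology_splice_neg_one_iso P Q⟩
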